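/- Let $k$ be a field of characteristic $0$ and let $A = k\langle x,y,z\rangle/(x^2+yx,\; xz,\; zy)$. For $n\ge 0$ let $HH^{-n}(A)=\operatorname{Ext}^n_{A\otimes A^{\mathrm{op}}}(A,A)$ be the Hochschild cohomology of $A$ (placed in non-positive degrees), computed by the reduced Hochschild cochain complex $C^{-n}(A)=\operatorname{Hom}_k((A/k)^{\otimes n},A)$ with the usual differential, and let $\cup_{-m,-n}\colon HH^{-m}(A)\otimes HH^{-n}(A)\to HH^{-m-n}(A)$ be the cup product, which is induced by $(f\cup g)(a_1\otimes\cdots\otimes a_{m+n})=(-1)^{mn}f(a_1\otimes\cdots\otimes a_m)\,g(a_{m+1}\otimes\cdots\otimes a_{m+n})$ on cochains. Then: 1. the map $k\to HH^0(A)$, $c\mapsto [c\cdot 1_A]$, is an isomorphism, and under this identification $\cup_{-n,0}$ and $\cup_{0,-n}$ are the identity of $HH^{-n}(A)$ for every $n\ge 0$, that is, $\alpha\cup[c\cdot 1_A]=[c\cdot 1_A]\cup\alpha=c\,\alpha$ for all $c\in k$ and $\alpha\in HH^{-n}(A)$; 2. $\cup_{-m,-n}=0$ for all $m,n\ge 1$.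 In particular $\cup_{-1,-1}=0$ and $\cup_{-2,-2}=0$. -/

import Mathlib

/-! Hochschild cohomology through the reduced bar cochain complex, its cup product, and the algebra
`k⟨x, y, z⟩ / (x² + yx, xz, zy)`.  Cohomological degree `n : ℕ` stands for the degree `-n` of the
convention in which Hochschild cohomology sits in non-positive degrees. -/

namespace Hochschild

section General

variable (k : Type*) [Field k] (A : Type*) [Ring A] [Algebra k A]

/-- The `k`-multilinear maps `Aⁿ → A` that
vanish as soon as one argument is `1` (hence as soon as one argument is a scalar). -/
def reducedMaps (n : ℕ) : Submodule k (MultilinearMap k (fun _ : Fin n => A) A) where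
  carrier := {f | ∀ (a : Fin n → A) (i : Fin n), a i = 1 → f a = 0}
  add_mem' := by
    intro f g hf hg a i h
    simp [hf a i h, hg a i h]
  zero_mem' := by
    intro a i _
    simp
  smul_mem' := by
    intro c f hf a i h
    simp [hf a i h]

/-- Reduced Hochschild `n`-cochains `Hom_k((A/k)^{⊗ n}, A)`. -/
def Cochain (n : ℕ) : Type _ := reducedMaps k A n

instance (n : ℕ) : AddCommGroup (Cochain k A n) := inferInstanceAs (AddCommGroup (reducedMaps k A n))

instance (n : ℕ) : Module k (Cochain k A n) := inferInstanceAs (Module k (reducedMaps k A n))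

variable {k A}

/-- The multilinear map underlying a cochain. -/
def Cochain.toMap {n : ℕ} (f : Cochain k A n) : MultilinearMap k (fun _ : Fin n => A) A :=
  Subtype.val f

/-- The cochain given by a reduced multilinear map. -/
def Cochain.mk {n : ℕ} (f : MultilinearMap k (fun _ : Fin n => A) A)
    (hf : f ∈ reducedMaps k A n) : Cochain k A n :=
  Subtype.mk f hf

theorem Cochain.mem {n : ℕ} (f : Cochain k A n) : f.toMap ∈ reducedMaps k A n := Subtype.prop f

@[ext]
theorem Cochain.ext {n : ℕ} {f g : Cochain k A n}
    (h : ∀ a : Fin n → A, f.toMap a = g.toMap a) : f = g :=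
  Subtype.ext (MultilinearMap.ext h)

@[simp]
theorem Cochain.toMap_mk {n : ℕ} (f : MultilinearMap k (fun _ : Fin n => A) A)
    (hf : f ∈ reducedMaps k A n) : (Cochain.mk f hf).toMap = f := rfl

@[simp]
theorem Cochain.toMap_zero (n : ℕ) : (0 : Cochain k A n).toMap = 0 := rfl

@[simp]
theorem Cochain.toMap_add {n : ℕ} (f g : Cochain k A n) :
    (f + g).toMap = f.toMap + g.toMap := rfl

@[simp]
theorem Cochain.toMap_smul {n : ℕ} (c : k) (f : Cochain k A n) :
    (c • f).toMap = c • f.toMap := rfl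

/-- `(a₁, …, aₙ₊₁) ↦ a₁ f(a₂, …, aₙ₊₁)`. -/
def leftFace {n : ℕ} (f : MultilinearMap k (fun _ : Fin n => A) A) :
    MultilinearMap k (fun _ : Fin (n + 1) => A) A :=
  MultilinearMap.mk' (fun a => a 0 * f (fun i => a i.succ))
    (by
      intro a i x y
      induction i using Fin.cases with
      | zero => simp [add_mul]
      | succ i =>
        have h : ∀ t : A, (fun l : Fin n => Function.update a i.succ t l.succ) =
            Function.update (fun l : Fin n => a l.succ) i t := by
          intro t; ext l; by_cases hl : l = i <;> simp [Function.update, hl]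
        simp [h, mul_add, (Fin.succ_ne_zero i).symm])
    (by
      intro a i c x
      induction i using Fin.cases with
      | zero => simp
      | succ i =>
        have h : ∀ t : A, (fun l : Fin n => Function.update a i.succ t l.succ) =
            Function.update (fun l : Fin n => a l.succ) i t := by
          intro t; ext l; by_cases hl : l = i <;> simp [Function.update, hl]
        simp [h, (Fin.succ_ne_zero i).symm])

/-- `(a₁, …, aₙ₊₁) ↦ f(a₁, …, aₙ) aₙ₊₁`. -/
def rightFace {n : ℕ} (f : MultilinearMap k (fun _ : Fin n => A) A) :
    MultilinearMap k (fun _ : Fin (n + 1) => A) A :=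
  MultilinearMap.mk' (fun a => f (fun i => a i.castSucc) * a (Fin.last n))
    (by
      intro a i x y
      induction i using Fin.lastCases with
      | last => simp [mul_add, Fin.castSucc_ne_last]
      | cast i =>
        have h : ∀ t : A, (fun l : Fin n => Function.update a i.castSucc t l.castSucc) =
            Function.update (fun l : Fin n => a l.castSucc) i t := by
          intro t; ext l; by_cases hl : l = i <;> simp [Function.update, hl]
        simp [h, add_mul, (Fin.castSucc_ne_last i).symm])
    (by
      intro a i c x
      induction i using Fin.lastCases with
      | last => simp [Fin.castSucc_ne_last]
      | cast i =>
        have h : ∀ t : A, (fun l : Fin n => Function.update a i.castSucc t l.castSucc) =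
            Function.update (fun l : Fin n => a l.castSucc) i t := by
          intro t; ext l; by_cases hl : l = i <;> simp [Function.update, hl]
        simp [h, (Fin.castSucc_ne_last i).symm])

theorem contractNth_update {n : ℕ} (j : Fin n) (a : Fin (n + 1) → A) (i : Fin (n + 1)) :
    ∃ (i' : Fin n) (L : A →ₗ[k] A), ∀ t : A,
      Fin.contractNth j.castSucc (· * ·) (Function.update a i t) =
        Function.update (Fin.contractNth j.castSucc (· * ·) a) i' (L t) := by
  have hi := i.2
  rcases lt_trichotomy (i : ℕ) j with h | h | h
  · refine ⟨⟨i, by omega⟩, LinearMap.id, fun t => ?_⟩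
    ext l
    simp only [Fin.contractNth, Function.update_apply, Fin.ext_iff, Fin.val_castSucc, Fin.val_succ,
      LinearMap.id_apply]
    split_ifs <;> first | rfl | omega
  · refine ⟨j, LinearMap.mulRight k (a j.succ), fun t => ?_⟩
    ext l
    simp only [Fin.contractNth, Function.update_apply, Fin.ext_iff, Fin.val_castSucc, Fin.val_succ,
      LinearMap.mulRight_apply]
    split_ifs <;> first | rfl | omega | (congr 2; ext; simp; omega)
  · obtain h | h := Nat.eq_or_lt_of_le h
    · refine ⟨j, LinearMap.mulLeft k (a j.castSucc), fun t => ?_⟩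
      ext l
      simp only [Fin.contractNth, Function.update_apply, Fin.ext_iff, Fin.val_castSucc,
        Fin.val_succ, LinearMap.mulLeft_apply]
      split_ifs <;> first | rfl | omega | (congr 2; ext; simp; omega)
    · refine ⟨⟨i - 1, by omega⟩, LinearMap.id, fun t => ?_⟩
      ext l
      simp only [Fin.contractNth, Function.update_apply, Fin.ext_iff, Fin.val_castSucc,
        Fin.val_succ, LinearMap.id_apply]
      split_ifs <;> first | rfl | omega

/-- `(a₁, …, aₙ₊₁) ↦ f(a₁, …, aⱼ aⱼ₊₁, …, aₙ₊₁)`. -/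
def middleFace {n : ℕ} (j : Fin n) (f : MultilinearMap k (fun _ : Fin n => A) A) :
    MultilinearMap k (fun _ : Fin (n + 1) => A) A :=
  MultilinearMap.mk' (fun a => f (Fin.contractNth j.castSucc (· * ·) a))
    (by
      intro a i x y
      obtain ⟨i', L, h⟩ := contractNth_update (k := k) j a i
      simp [h])
    (by
      intro a i c x
      obtain ⟨i', L, h⟩ := contractNth_update (k := k) j a i
      simp [h])

/-- `(df)(a₁, …, aₙ₊₁) = a₁ f(a₂, …, aₙ₊₁) + ∑ⱼ (-1)ʲ f(a₁, …, aⱼ aⱼ₊₁, …, aₙ₊₁)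
+ (-1)ⁿ⁺¹ f(a₁, …, aₙ) aₙ₊₁` (the index `j` of the code starts at `0`). -/
def dFun {n : ℕ} (f : MultilinearMap k (fun _ : Fin n => A) A) :
    MultilinearMap k (fun _ : Fin (n + 1) => A) A :=
  leftFace f + ∑ j : Fin n, (-1 : k) ^ ((j : ℕ) + 1) • middleFace j f
    + (-1 : k) ^ (n + 1) • rightFace f

theorem dFun_apply {n : ℕ} (f : MultilinearMap k (fun _ : Fin n => A) A) (a : Fin (n + 1) → A) :
    dFun f a = a 0 * f (fun i => a i.succ)
      + ∑ j : Fin n, (-1 : k) ^ ((j : ℕ) + 1) • f (Fin.contractNth j.castSucc (· * ·) a)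
      + (-1 : k) ^ (n + 1) • (f (fun i => a i.castSucc) * a (Fin.last n)) := by
  simp [dFun, leftFace, middleFace, rightFace]

/-- The contraction of a sequence at the places `j` and `j + 1`. -/
def contr (j : ℕ) (b : ℕ → A) : ℕ → A := fun l =>
  if l < j then b l else if l = j then b l * b (l + 1) else b (l + 1)

theorem dFun_seq {n : ℕ} (f : MultilinearMap k (fun _ : Fin n => A) A) (b : ℕ → A) :
    dFun f (fun i => b i) = b 0 * f (fun i => b (i + 1))
      + ∑ j ∈ Finset.range n, (-1 : k) ^ (j + 1) • f (fun i => contr j b i)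
      + (-1 : k) ^ (n + 1) • (f (fun i => b i) * b n) := by
  rw [dFun_apply, Finset.sum_range]
  have h : ∀ j : Fin n, Fin.contractNth j.castSucc (· * ·) (fun i : Fin (n + 1) => b i) =
      fun i : Fin n => contr j b i := by
    intro j; ext i; simp [Fin.contractNth, contr]
  simp [h]

theorem exists_seq {n : ℕ} (a : Fin n → A) : ∃ b : ℕ → A, a = fun i : Fin n => b i :=
  ⟨fun l => if h : l < n then a ⟨l, h⟩ else 0, by ext i; simp⟩

theorem sum_two_eq_zero (e : ℕ → A) (i N : ℕ) (hi : i < N)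
    (h : ∀ j < N + 1, j ≠ i → j ≠ i + 1 → e j = 0) (he : e i = e (i + 1)) :
    ∑ j ∈ Finset.range (N + 1), (-1 : k) ^ j • e j = 0 := by
  rw [← Finset.sum_subset (s₁ := {i, i + 1})]
  · rw [Finset.sum_pair (by omega), he, pow_succ]
    simp
  · intro j hj
    simp only [Finset.mem_insert, Finset.mem_singleton] at hj
    simp only [Finset.mem_range]
    omega
  · intro j hj hj'
    simp only [Finset.mem_insert, Finset.mem_singleton, not_or] at hj'
    rw [h j (Finset.mem_range.1 hj) hj'.1 hj'.2, smul_zero]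

theorem sum_sum_eq_zero (G : ℕ → ℕ → A) (hG : ∀ i j, i ≤ j → G i j = G (j + 1) i) (n : ℕ) :
    ∑ i ∈ Finset.range (n + 1), ∑ j ∈ Finset.range n, (-1 : k) ^ (i + j) • G i j = 0 := by
  induction n with
  | zero => simp
  | succ n ih =>
    rw [Finset.sum_range_succ]
    have h1 : ∀ i ∈ Finset.range (n + 1), ∑ j ∈ Finset.range (n + 1), (-1 : k) ^ (i + j) • G i j =
        ∑ j ∈ Finset.range n, (-1 : k) ^ (i + j) • G i j + (-1 : k) ^ (i + n) • G i n :=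
      fun i _ => Finset.sum_range_succ _ n
    rw [Finset.sum_congr rfl h1, Finset.sum_add_distrib, ih, zero_add, ← Finset.sum_add_distrib]
    refine Finset.sum_eq_zero fun i hi => ?_
    rw [hG i n (by have := Finset.mem_range.1 hi; omega), ← add_smul]
    rw [show n + 1 + i = i + n + 1 by omega, pow_succ]
    simp

theorem contr_contr (i j : ℕ) (h : i ≤ j) (b : ℕ → A) :
    contr j (contr i b) = contr i (contr (j + 1) b) := by
  ext l
  simp only [contr]
  split_ifs <;> first | omega | rfl | simp [mul_assoc]

theorem dFun_mem {n : ℕ} {f : MultilinearMap k (fun _ : Fin n => A) A} (hf : f ∈ reducedMaps k A n) :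
    dFun f ∈ reducedMaps k A (n + 1) := by
  intro a i hi
  obtain ⟨b, rfl⟩ := exists_seq a
  obtain ⟨i, hin⟩ := i
  replace hi : b i = 1 := hi
  have hf' : ∀ (c : ℕ → A) (l : ℕ), l < n → c l = 1 → f (fun i => c i) = 0 :=
    fun c l hl hc => hf _ ⟨l, hl⟩ hc
  have hL : i ≠ 0 → f (fun l => b (l + 1)) = 0 := fun h =>
    hf' (fun l => b (l + 1)) (i - 1) (by omega) (by simpa [Nat.sub_add_cancel (Nat.pos_of_ne_zero h)])
  have hR : i ≠ n → f (fun l => b l) = 0 := fun h => hf' b i (by omega) hi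
  have hM : ∀ j < n, j ≠ i → j + 1 ≠ i → f (fun l => contr j b l) = 0 := by
    intro j hj h1 h2
    rcases lt_or_gt_of_ne h1 with h | h
    · refine hf' (contr j b) (i - 1) (by omega) ?_
      have e : i - 1 + 1 = i := by omega
      simp only [contr, e]
      rw [if_neg (by omega), if_neg (by omega), hi]
    · refine hf' (contr j b) i (by omega) ?_
      simp only [contr]
      rw [if_pos (by omega), hi]
  set e : ℕ → A := fun j => if j = 0 then b 0 * f (fun l => b (l + 1)) else
    if j = n + 1 then f (fun l => b l) * b n else f (fun l => contr (j - 1) b l) with he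
  have hsum : dFun f (fun l => b l) = ∑ j ∈ Finset.range (n + 1 + 1), (-1 : k) ^ j • e j := by
    rw [dFun_seq, Finset.sum_range_succ, Finset.sum_range_succ']
    have : ∀ j ∈ Finset.range n, (-1 : k) ^ (j + 1) • e (j + 1) =
        (-1 : k) ^ (j + 1) • f (fun l => contr j b l) := by
      intro j hj
      have := Finset.mem_range.1 hj
      simp [he, show j ≠ n by omega]
    rw [Finset.sum_congr rfl this]
    simp [he]
    abel
  rw [hsum, sum_two_eq_zero e i (n + 1) hin]
  · intro j hj h1 h2
    simp only [he]
    split_ifs with h3 h4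
    · rw [hL (by omega), mul_zero]
    · rw [hR (by omega), zero_mul]
    · exact hM _ (by omega) (by omega) (by omega)
  · simp only [he]
    by_cases h0 : i = 0
    · subst h0
      by_cases hn : n = 0
      · subst hn
        simp [hi, Subsingleton.elim (fun l : Fin 0 => b (l + 1)) (fun l : Fin 0 => b l)]
      · have : (0 : ℕ) + 1 ≠ n + 1 := by omega
        simp only [if_true, Nat.zero_add, one_ne_zero, if_false, if_neg this, hi, one_mul]
        congr 1
        ext l
        simp only [contr]
        split_ifs with h1 h2 <;> first | omega | simp_all
    · by_cases hn : i = n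
      · subst hn
        simp only [if_neg h0, if_true, if_neg (Nat.succ_ne_zero i), hi, mul_one]
        rw [if_neg (by omega)]
        congr 1
        ext l
        have := l.2
        have e1 : i - 1 + 1 = i := by omega
        simp only [contr]
        split_ifs with h1 h2 <;> first | omega | simp_all
      · rw [if_neg h0, if_neg (by omega), if_neg (by omega), if_neg (by omega)]
        congr 1
        ext l
        have e1 : i - 1 + 1 = i := by omega
        simp only [contr, Nat.add_sub_cancel]
        split_ifs with h1 h2 h3 h4 h5 <;> first | omega | rfl | skip
        all_goals simp_all

variable (k A)

/-- The differential of the reduced Hochschild cochain complex. -/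
def d (n : ℕ) : Cochain k A n →ₗ[k] Cochain k A (n + 1) where
  toFun f := Cochain.mk (dFun f.toMap) (dFun_mem f.mem)
  map_add' f g := by
    ext a
    simp [dFun_apply, mul_add, add_mul, Finset.sum_add_distrib]
    abel
  map_smul' c f := by
    ext a
    simp [dFun_apply, Finset.smul_sum, smul_comm c]

theorem d_d (n : ℕ) (f : Cochain k A n) : d k A (n + 1) (d k A n f) = 0 := by
  ext a
  obtain ⟨b, rfl⟩ := exists_seq a
  change dFun (dFun f.toMap) _ = 0
  have hS := sum_sum_eq_zero (k := k) (fun i j => f.toMap (fun l => contr j (contr i b) l))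
    (fun i j h => by rw [contr_contr i j h]) n
  rw [dFun_seq, dFun_seq f.toMap b, dFun_seq f.toMap (fun l => b (l + 1))]
  simp only [dFun_seq f.toMap (contr _ b), smul_add, Finset.sum_add_distrib, Finset.smul_sum,
    smul_smul, ← pow_add]
  have hS' : ∑ i ∈ Finset.range (n + 1), ∑ j ∈ Finset.range n,
      (-1 : k) ^ (i + 1 + (j + 1)) • f.toMap (fun l => contr j (contr i b) l) = 0 := by
    rw [← hS]
    refine Finset.sum_congr rfl fun i _ => Finset.sum_congr rfl fun j _ => ?_
    rw [show i + 1 + (j + 1) = i + j + 2 by omega, pow_add]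
    simp
  rw [hS']
  rw [Finset.sum_range_succ' (fun i => (-1 : k) ^ (i + 1) •
    (contr i b 0 * f.toMap fun l => contr i b (l + 1)))]
  rw [Finset.sum_range_succ (fun i => (-1 : k) ^ (i + 1 + (n + 1)) •
    ((f.toMap fun l => contr i b l) * contr i b n))]
  have h1 : ∀ i, (fun l : Fin n => contr (i + 1) b (l + 1)) =
      fun l : Fin n => contr i (fun l => b (l + 1)) l := by
    intro i; ext l; simp [contr]
  have h2 : ∀ i, contr (i + 1) b 0 = b 0 := by intro i; simp [contr]
  have h3 : contr 0 b 0 = b 0 * b 1 := by simp [contr]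
  have h4 : (fun l : Fin n => contr 0 b (l + 1)) = fun l : Fin n => b (l + 1 + 1) := by
    ext l; simp [contr]
  have h5 : contr n b n = b n * b (n + 1) := by simp [contr]
  have h6 : (fun l : Fin n => contr n b l) = fun l : Fin n => b l := by
    ext l; simp [contr]
  have h7 : ∑ i ∈ Finset.range n, (-1 : k) ^ (i + 1 + (n + 1)) •
      ((f.toMap fun l => contr i b l) * contr i b n) =
      ∑ i ∈ Finset.range n, (-1 : k) ^ (i + 1 + (n + 1)) •
        ((f.toMap fun l => contr i b l) * b (n + 1)) := by
    refine Finset.sum_congr rfl fun i hi => ?_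
    have := Finset.mem_range.1 hi
    have e : contr i b n = b (n + 1) := by
      simp [contr, show ¬ n < i by omega, show ¬ n = i by omega]
    rw [e]
  rw [h7]
  simp only [h1, h2, h3, h4, h5, h6, mul_add, add_mul, Finset.mul_sum, Finset.sum_mul, smul_add,
    Finset.smul_sum, smul_mul_assoc, mul_smul_comm, smul_smul, mul_assoc, pow_add]
  rcases neg_one_pow_eq_or k n with hn | hn <;>
  · simp [hn]
    abel

/-- Hochschild `n`-cocycles. -/
def cocycles (n : ℕ) : Submodule k (Cochain k A n) := LinearMap.ker (d k A n)

/-- Hochschild `n`-coboundaries. -/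
def coboundaries : (n : ℕ) → Submodule k (Cochain k A n)
  | 0 => ⊥
  | n + 1 => LinearMap.range (d k A n)

/-- The Hochschild cohomology `HH^{-n}(A) = Ext^n_{A^e}(A, A)`, computed by the reduced bar
resolution: cocycles modulo coboundaries. -/
abbrev HH (n : ℕ) : Type _ :=
  cocycles k A n ⧸ (coboundaries k A n).submoduleOf (cocycles k A n)

theorem coboundaries_le_cocycles (n : ℕ) : coboundaries k A n ≤ cocycles k A n := by
  cases n with
  | zero => exact bot_le
  | succ n =>
    rintro _ ⟨f, rfl⟩
    exact d_d k A n f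

variable {k A}

theorem exists_place {m n : ℕ} (i : Fin (m + n)) :
    (∃ j : Fin m, i = Fin.castAdd n j) ∨ ∃ j : Fin n, i = Fin.natAdd m j := by
  induction i using Fin.addCases with
  | left j => exact Or.inl ⟨j, rfl⟩
  | right j => exact Or.inr ⟨j, rfl⟩

theorem update_castAdd {X : Type*} {m n : ℕ} (a : Fin (m + n) → X) (i : Fin m) (t : X) :
    (fun l : Fin m => Function.update a (Fin.castAdd n i) t (Fin.castAdd n l)) =
      Function.update (fun l : Fin m => a (Fin.castAdd n l)) i t := by
  ext l
  simp [Function.update_apply]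

theorem update_castAdd' {X : Type*} {m n : ℕ} (a : Fin (m + n) → X) (i : Fin m) (t : X) :
    (fun l : Fin n => Function.update a (Fin.castAdd n i) t (Fin.natAdd m l)) =
      fun l : Fin n => a (Fin.natAdd m l) := by
  ext l
  have := i.2
  rw [Function.update_of_ne]
  simp only [ne_eq, Fin.ext_iff, Fin.val_natAdd, Fin.val_castAdd]
  omega

theorem update_natAdd {X : Type*} {m n : ℕ} (a : Fin (m + n) → X) (i : Fin n) (t : X) :
    (fun l : Fin n => Function.update a (Fin.natAdd m i) t (Fin.natAdd m l)) =
      Function.update (fun l : Fin n => a (Fin.natAdd m l)) i t := by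
  ext l
  simp [Function.update_apply]

theorem update_natAdd' {X : Type*} {m n : ℕ} (a : Fin (m + n) → X) (i : Fin n) (t : X) :
    (fun l : Fin m => Function.update a (Fin.natAdd m i) t (Fin.castAdd n l)) =
      fun l : Fin m => a (Fin.castAdd n l) := by
  ext l
  have := l.2
  rw [Function.update_of_ne]
  simp only [ne_eq, Fin.ext_iff, Fin.val_natAdd, Fin.val_castAdd]
  omega

/-- `(f ∪ g)(a₁, …, aₘ₊ₙ) = (-1)^{mn} f(a₁, …, aₘ) g(aₘ₊₁, …, aₘ₊ₙ)`. -/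
def cupFun {m n p : ℕ} (h : m + n = p) (f : MultilinearMap k (fun _ : Fin m => A) A)
    (g : MultilinearMap k (fun _ : Fin n => A) A) : MultilinearMap k (fun _ : Fin p => A) A :=
  (-1 : k) ^ (m * n) • MultilinearMap.mk'
    (fun a => f (fun i => a (Fin.cast h (Fin.castAdd n i))) *
      g (fun j => a (Fin.cast h (Fin.natAdd m j))))
    (by
      subst h
      intro a i x y
      obtain ⟨i, rfl⟩ | ⟨i, rfl⟩ := exists_place i
      · simp [update_castAdd, update_castAdd', add_mul]
      · simp [update_natAdd, update_natAdd', mul_add])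
    (by
      subst h
      intro a i c x
      obtain ⟨i, rfl⟩ | ⟨i, rfl⟩ := exists_place i
      · simp [update_castAdd, update_castAdd']
      · simp [update_natAdd, update_natAdd'])

theorem cupFun_apply {m n p : ℕ} (h : m + n = p) (f : MultilinearMap k (fun _ : Fin m => A) A)
    (g : MultilinearMap k (fun _ : Fin n => A) A) (a : Fin p → A) :
    cupFun h f g a = (-1 : k) ^ (m * n) • (f (fun i => a (Fin.cast h (Fin.castAdd n i))) *
      g (fun j => a (Fin.cast h (Fin.natAdd m j)))) := rfl

theorem cupFun_mem {m n p : ℕ} (h : m + n = p) {f : MultilinearMap k (fun _ : Fin m => A) A}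
    {g : MultilinearMap k (fun _ : Fin n => A) A} (hf : f ∈ reducedMaps k A m)
    (hg : g ∈ reducedMaps k A n) : cupFun h f g ∈ reducedMaps k A p := by
  subst h
  intro a i hi
  rw [cupFun_apply]
  obtain ⟨i, rfl⟩ | ⟨i, rfl⟩ := exists_place i
  · rw [hf _ i hi, zero_mul, smul_zero]
  · rw [hg _ i hi, mul_zero, smul_zero]

variable (k A)

/-- The cup product of reduced Hochschild cochains, in degrees `m` and `n` with `m + n = p`. -/
def cupCochain {m n p : ℕ} (h : m + n = p) :
    Cochain k A m →ₗ[k] Cochain k A n →ₗ[k] Cochain k A p :=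
  LinearMap.mk₂ k (fun f g => Cochain.mk (cupFun h f.toMap g.toMap) (cupFun_mem h f.mem g.mem))
    (by intro f f' g; ext a; simp [cupFun_apply, add_mul])
    (by intro c f g; ext a; simp [cupFun_apply, smul_comm c])
    (by intro f g g'; ext a; simp [cupFun_apply, mul_add])
    (by intro c f g; ext a; simp [cupFun_apply, smul_comm c])

theorem cupCochain_seq {m n p : ℕ} (h : m + n = p) (f : Cochain k A m) (g : Cochain k A n)
    (b : ℕ → A) : (cupCochain k A h f g).toMap (fun i => b i) =
      (-1 : k) ^ (m * n) • (f.toMap (fun i => b i) * g.toMap (fun j => b (m + j))) := rfl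

/-- The Leibniz rule. -/
theorem d_cupCochain {m n p : ℕ} (h : m + n = p) (h₁ : (m + 1) + n = p + 1)
    (h₂ : m + (n + 1) = p + 1) (f : Cochain k A m) (g : Cochain k A n) :
    d k A p (cupCochain k A h f g) =
      (-1 : k) ^ n • cupCochain k A h₁ (d k A m f) g + cupCochain k A h₂ f (d k A n g) := by
  subst h
  ext a
  obtain ⟨b, rfl⟩ := exists_seq a
  rw [Cochain.toMap_add, Cochain.toMap_smul, add_apply, smul_apply,
    cupCochain_seq, cupCochain_seq]
  change dFun (cupCochain k A rfl f g).toMap _ = (-1 : k) ^ n • ((-1 : k) ^ ((m + 1) * n) •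
    (dFun f.toMap (fun i => b i) * _)) + (-1 : k) ^ (m * (n + 1)) •
    (_ * dFun g.toMap (fun j => b (m + j)))
  rw [dFun_seq, dFun_seq, dFun_seq g.toMap (fun l => b (m + l)), Finset.sum_range_add]
  rw [cupCochain_seq k A rfl f g (fun l => b (l + 1)), cupCochain_seq k A rfl f g b]
  simp only [cupCochain_seq k A rfl f g (contr _ b)]
  have h1 : ∀ i ∈ Finset.range m, (-1 : k) ^ (i + 1) • (-1 : k) ^ (m * n) •
      ((f.toMap fun l => contr i b l) * g.toMap fun l => contr i b (m + l)) =
      (-1 : k) ^ (i + 1) • (-1 : k) ^ (m * n) •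
      ((f.toMap fun l => contr i b l) * g.toMap fun l => b (m + 1 + l)) := by
    intro i hi
    have hi := Finset.mem_range.1 hi
    congr 4
    ext l
    simp only [contr]
    rw [if_neg (by omega), if_neg (by omega)]
    congr 1
    omega
  have h2 : ∀ i ∈ Finset.range n, (-1 : k) ^ (m + i + 1) • (-1 : k) ^ (m * n) •
      ((f.toMap fun l => contr (m + i) b l) * g.toMap fun l => contr (m + i) b (m + l)) =
      (-1 : k) ^ (m + i + 1) • (-1 : k) ^ (m * n) •
      ((f.toMap fun l => b l) * g.toMap fun l => contr i (fun l => b (m + l)) l) := by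
    intro i hi
    have e1 : (fun l : Fin m => contr (m + i) b l) = fun l : Fin m => b l := by
      ext l
      have := l.2
      simp only [contr]
      rw [if_pos (by omega)]
    have e2 : (fun l : Fin n => contr (m + i) b (m + l)) =
        fun l : Fin n => contr i (fun l => b (m + l)) l := by
      ext l
      simp [contr, add_assoc]
    rw [e1, e2]
  rw [Finset.sum_congr rfl h1, Finset.sum_congr rfl h2]
  have h3 : (fun l : Fin n => b (m + l + 1)) = fun l : Fin n => b (m + 1 + l) := by
    ext l; congr 1; omega
  have h4 : (fun l : Fin n => b (m + (l + 1))) = fun l : Fin n => b (m + 1 + l) := by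
    ext l; congr 1; omega
  simp only [h3, h4, mul_add, add_mul, Finset.mul_sum, Finset.sum_mul, smul_add,
    Finset.smul_sum, smul_mul_assoc, mul_smul_comm, smul_smul, mul_assoc, pow_add, pow_mul]
  rcases neg_one_pow_eq_or k n with hn | hn <;> rcases neg_one_pow_eq_or k m with hm | hm <;>
  · simp [hn, hm]
    try abel

/-- The cup product of cocycles. -/
def cupCocycle {m n p : ℕ} (h : m + n = p) :
    cocycles k A m →ₗ[k] cocycles k A n →ₗ[k] cocycles k A p :=
  LinearMap.mk₂ k
    (fun f g => ⟨cupCochain k A h f.1 g.1, by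
      have hf : d k A m f.1 = 0 := f.2
      have hg : d k A n g.1 = 0 := g.2
      change d k A p _ = 0
      rw [d_cupCochain k A h (by omega) (by omega), hf, hg]
      simp⟩)
    (by intro f f' g; ext1; simp)
    (by intro c f g; ext1; simp)
    (by intro f g g'; ext1; simp)
    (by intro c f g; ext1; simp)

theorem cup_coboundary_left {m n p : ℕ} (h : m + n = p) {f : Cochain k A m} {g : Cochain k A n}
    (hf : f ∈ coboundaries k A m) (hg : g ∈ cocycles k A n) :
    cupCochain k A h f g ∈ coboundaries k A p := by
  cases m with
  | zero =>
    obtain rfl : f = 0 := hf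
    simp
  | succ m =>
    obtain ⟨e, rfl⟩ := hf
    have hg : d k A n g = 0 := hg
    obtain ⟨q, rfl⟩ : ∃ q, p = q + 1 := ⟨m + n, by omega⟩
    refine ⟨(-1 : k) ^ n • cupCochain k A (by omega) e g, ?_⟩
    rw [map_smul, d_cupCochain k A (by omega) h (by omega), hg, map_zero, add_zero, smul_smul,
      ← mul_pow]
    simp

theorem cup_coboundary_right {m n p : ℕ} (h : m + n = p) {f : Cochain k A m} {g : Cochain k A n}
    (hf : f ∈ cocycles k A m) (hg : g ∈ coboundaries k A n) :
    cupCochain k A h f g ∈ coboundaries k A p := by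
  cases n with
  | zero =>
    obtain rfl : g = 0 := hg
    simp
  | succ n =>
    obtain ⟨e, rfl⟩ := hg
    have hf : d k A m f = 0 := hf
    obtain ⟨q, rfl⟩ : ∃ q, p = q + 1 := ⟨m + n, by omega⟩
    refine ⟨cupCochain k A (by omega) f e, ?_⟩
    rw [d_cupCochain k A (by omega) (by omega) h, hf]
    simp

/-- The cup product `HH^{-m}(A) × HH^{-n}(A) → HH^{-p}(A)`, `p = m + n`, induced by the cup product
of cochains. -/
def cup {m n p : ℕ} (h : m + n = p) : HH k A m →ₗ[k] HH k A n →ₗ[k] HH k A p :=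
  (Submodule.liftQ _
    (Submodule.liftQ _
      ((cupCocycle k A h).compr₂ (Submodule.mkQ _))
      (by
        intro f hf
        ext g
        exact (Submodule.Quotient.mk_eq_zero _).2
          (cup_coboundary_left k A h hf g.2))).flip
    (by
      intro g hg
      ext f
      exact (Submodule.Quotient.mk_eq_zero _).2
        (cup_coboundary_right k A h f.2 hg))).flip

/-- The map `k → HH^0(A)` that sends `c` to the class of the `0`-cochain `c · 1_A`. -/
def scalarClass : k →ₗ[k] HH k A 0 :=
  (Submodule.mkQ _).comp
    (LinearMap.toSpanSingleton k (cocycles k A 0)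
      ⟨Cochain.mk (MultilinearMap.constOfIsEmpty k (fun _ : Fin 0 => A) 1) fun _ i => i.elim0, by
        change d k A 0 _ = 0
        ext a
        change dFun (MultilinearMap.constOfIsEmpty k (fun _ : Fin 0 => A) 1) a = 0
        simp [dFun_apply]⟩)

end General

end Hochschild

/-- The three generators. -/
inductive Gen
  | x
  | y
  | z

/-- The relations `x² + yx = 0`, `xz = 0`, `zy = 0`. -/
inductive ISRel (k : Type*) [Field k] : FreeAlgebra k Gen → FreeAlgebra k Gen → Prop
  | xx_yx : ISRel k (FreeAlgebra.ι k Gen.x * FreeAlgebra.ι k Gen.x +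
      FreeAlgebra.ι k Gen.y * FreeAlgebra.ι k Gen.x) 0
  | xz : ISRel k (FreeAlgebra.ι k Gen.x * FreeAlgebra.ι k Gen.z) 0
  | zy : ISRel k (FreeAlgebra.ι k Gen.z * FreeAlgebra.ι k Gen.y) 0

/-- The algebra `k⟨x, y, z⟩ / (x² + yx, xz, zy)`. -/
abbrev ISAlg (k : Type*) [Field k] : Type _ := RingQuot (ISRel k)

/-! With w = x + y the relations become wx = xz = zy = 0, where y = w - x. They form a single line
of letters w, x, z, y, and `A` behaves like a Koszul algebra whose n-th syzygies are spanned by the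
segments of that line: w, x, z for n = 1; wx, xz, zy; wxz, xzy; wxzy; and none for n ≥ 5.
Accordingly a cocycle of degree 2, 3 or 4 that vanishes on the segments of its length is a
coboundary, and every cocycle of degree at least 5 is one (`exists_primitive_two` to
`exists_primitive_five`). These criteria hold for all bimodules M: an (n+1)-cochain with values in M
is an n-cochain with values in Hom_k(A/k, M), so each degree reduces to the previous one, and degree
n + 5 is degree 5 with other coefficients.

Coefficients in `A` also give HH^3 = 0. Hence for m, n ≥ 1 only the pairs (1,1) and (2,2) need work:
every other product lands in HH^3 or in degree at least 5, or has a factor in HH^3.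

For (2,2) only the value f(w,x) g(z,y) at wxzy matters. The cocycle identities at wxz and xzy force
f(w,x) = wα + βx and g(z,y) = γy + zδ. As xz = 0, the product is w(α g(z,y)) + (βxγ)y, which is the
value of a coboundary.

For (1,1), subtracting inner derivations achieves f(w) = aw, and the relations then give f(x) = xc,
f(z) = ze - cz, f(y) = yh - ey, and likewise for g with primes. The one term of the cup product
without an evident primitive is z(eyh') at zy; `mul_gy_mul_mem` puts eyh' in xA + yA + Ay + Aw,
which suffices.

HH^0 is the centre, and it is k because right multiplication by w is injective. All equations in `A`
are solved with the direct sums A = k ⊕ wA ⊕ xA ⊕ zA = k ⊕ Ax ⊕ Ay ⊕ Az and the exact annihilators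
of the generators. -/

namespace Hochschild

-- Bimodule coefficients and dimension shifting

universe u v

/-- A `k`-central bimodule over the `k`-algebra `A`. -/
structure CoeffBimod (k : Type u) [Field k] (A : Type v) [Ring A] [Algebra k A] where
  carrier : Type v
  [addCommGroup : AddCommGroup carrier]
  [module : Module k carrier]
  /-- The left action. -/
  l : A →ₗ[k] carrier →ₗ[k] carrier
  /-- The right action. -/
  r : A →ₗ[k] carrier →ₗ[k] carrier
  l_one : ∀ m, l 1 m = m
  r_one : ∀ m, r 1 m = m
  l_mul : ∀ a b m, l (a * b) m = l a (l b m)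
  r_mul : ∀ a b m, r (a * b) m = r b (r a m)
  l_r : ∀ a b m, l a (r b m) = r b (l a m)

namespace CoeffBimod

variable {k : Type u} [Field k] {A : Type v} [Ring A] [Algebra k A]

instance : CoeSort (CoeffBimod k A) (Type v) := ⟨CoeffBimod.carrier⟩

instance (M : CoeffBimod k A) : AddCommGroup M := M.addCommGroup

instance (M : CoeffBimod k A) : Module k M := M.module

attribute [simp] l_one r_one

variable (k A) in
/-- The algebra as a bimodule over itself. -/
def regular : CoeffBimod k A where
  carrier := A
  l := LinearMap.mul k A
  r := (LinearMap.mul k A).flip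
  l_one m := by simp
  r_one m := by simp
  l_mul a b m := by simp [mul_assoc]
  r_mul a b m := by simp [mul_assoc]
  l_r a b m := by simp [mul_assoc]

/-- The linear maps `A → M` that vanish at `1`. -/
def normalizedMaps (M : CoeffBimod k A) : Submodule k (A →ₗ[k] M) where
  carrier := {φ | φ 1 = 0}
  add_mem' := by
    intro φ ψ hφ hψ
    simp_all
  zero_mem' := by simp
  smul_mem' := by
    intro c φ hφ
    simp_all

/-- `Hom_k(A / k, M)` with the bimodule structure `(aφ)(b) = a φ(b)`,
`(φa)(b) = φ(ab) - φ(a) b`. -/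
def shift (M : CoeffBimod k A) : CoeffBimod k A where
  carrier := M.normalizedMaps
  l := LinearMap.mk₂ k
    (fun a φ => ⟨(M.l a).comp φ.1, by
      have h : φ.1 1 = 0 := φ.2
      change M.l a (φ.1 1) = 0
      simp [h]⟩)
    (by intros; ext; simp) (by intros; ext; simp) (by intros; ext; simp) (by intros; ext; simp)
  r := LinearMap.mk₂ k
    (fun a φ => ⟨φ.1.comp (LinearMap.mulLeft k a) - M.r.flip (φ.1 a), by
      change φ.1 (a * 1) - M.r 1 (φ.1 a) = 0
      simp⟩)
    (by intros; ext; simp [add_mul]; abel) (by intros; ext; simp [smul_sub])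
    (by intros; ext; simp; abel) (by intros; ext; simp [smul_sub])
  l_one φ := by ext; simp
  r_one φ := by
    have h : φ.1 1 = 0 := φ.2
    ext; simp [h]
  l_mul a b φ := by ext; simp [M.l_mul]
  r_mul a b φ := by
    ext c
    simp [M.r_mul]
  l_r a b φ := by ext; simp [M.l_r]

/-- Evaluation of an element of `M.shift`. -/
def app {M : CoeffBimod k A} : M.shift →ₗ[k] A →ₗ[k] M := M.normalizedMaps.subtype

instance {M : CoeffBimod k A} : CoeFun M.shift (fun _ => A → M) := ⟨fun φ => app φ⟩

variable {M : CoeffBimod k A}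

@[ext]
theorem shift_ext {φ ψ : M.shift} (h : ∀ a, φ a = ψ a) : φ = ψ :=
  Subtype.ext (LinearMap.ext h)

@[simp]
theorem shift_one (φ : M.shift) : φ 1 = 0 := φ.2

@[simp]
theorem shift_l (a b : A) (φ : M.shift) : (M.shift.l a φ) b = M.l a (φ b) := rfl

@[simp]
theorem shift_r (a b : A) (φ : M.shift) : (M.shift.r a φ) b = φ (a * b) - M.r b (φ a) := rfl

/-- The element of `M.shift` given by a linear map that vanishes at `1`. -/
def ofLinear (φ : A →ₗ[k] M) (h : φ 1 = 0) : M.shift := ⟨φ, h⟩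

@[simp]
theorem ofLinear_app (φ : A →ₗ[k] M) (h : φ 1 = 0) (a : A) : (ofLinear φ h) a = φ a := rfl

variable (M) in
/-- The differential `m ↦ (a ↦ am - ma)`. -/
def diff : M →ₗ[k] M.shift :=
  LinearMap.codRestrict M.normalizedMaps (M.l - M.r).flip (by
    intro m
    change M.l 1 m - M.r 1 m = 0
    simp)

@[simp]
theorem diff_app (m : M) (a : A) : (M.diff m) a = M.l a m - M.r a m := rfl

/-- The kernel of `M.shift.diff` consists of the derivations A → M, and `M.diff m` is an inner
derivation. -/
theorem diff_diff (m : M) : M.shift.diff (M.diff m) = 0 := by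
  ext a b
  simp only [diff_app, map_sub, LinearMap.sub_apply, shift_l, shift_r, map_zero,
    LinearMap.zero_apply, M.l_mul, M.r_mul, M.l_r]
  abel

end CoeffBimod

/-! ### Iterated cochains and the reduced bar complex -/

variable (k : Type u) [Field k] (A : Type v) [Ring A] [Algebra k A]

/-- The reduced cochains in iterated form. -/
def iterCochain : ℕ → CoeffBimod k A
  | 0 => CoeffBimod.regular k A
  | n + 1 => (iterCochain n).shift

variable {k A}

/-- Evaluation of an iterated cochain at the first terms of a sequence. -/
def seqEval : (n : ℕ) → iterCochain k A n → (ℕ → A) → A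
  | 0, m, _ => m
  | n + 1, φ, b => seqEval n (CoeffBimod.app (M := iterCochain k A n) φ (b 0)) (fun i => b (i + 1))

theorem seqEval_add (n : ℕ) (φ ψ : iterCochain k A n) (b : ℕ → A) :
    seqEval n (φ + ψ) b = seqEval n φ b + seqEval n ψ b := by
  induction n generalizing b with
  | zero => rfl
  | succ n ih =>
    simp only [seqEval]
    rw [← ih]
    congr 1

theorem seqEval_smul (n : ℕ) (c : k) (φ : iterCochain k A n) (b : ℕ → A) :
    seqEval n (c • φ) b = c • seqEval n φ b := by
  induction n generalizing b with
  | zero => rfl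
  | succ n ih =>
    simp only [seqEval]
    rw [← ih]
    congr 1

theorem seqEval_zero (n : ℕ) (b : ℕ → A) : seqEval n (0 : iterCochain k A n) b = 0 := by
  simpa using seqEval_smul n (0 : k) 0 b

theorem seqEval_sub (n : ℕ) (φ ψ : iterCochain k A n) (b : ℕ → A) :
    seqEval n (φ - ψ) b = seqEval n φ b - seqEval n ψ b := by
  rw [sub_eq_add_neg, ← neg_one_smul k ψ, seqEval_add, seqEval_smul, neg_one_smul,
    sub_eq_add_neg]

theorem seqEval_l (n : ℕ) (a : A) (φ : iterCochain k A n) (b : ℕ → A) :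
    seqEval n ((iterCochain k A n).l a φ) b = a * seqEval n φ b := by
  induction n generalizing b with
  | zero => rfl
  | succ n ih =>
    simp only [seqEval]
    rw [← ih]
    rfl

/-- Each shift contributes one product of neighbouring arguments and hands minus the right action to
the next level. Unrolled, the right action yields all inner faces and the last face. -/
theorem seqEval_r (n : ℕ) (φ : iterCochain k A n) (b : ℕ → A) :
    seqEval n ((iterCochain k A n).r (b 0) φ) (fun i => b (i + 1)) =
      ∑ j ∈ Finset.range n, (-1 : k) ^ j • seqEval n φ (contr j b) +
        (-1 : k) ^ n • (seqEval n φ b * b n) := by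
  induction n generalizing b with
  | zero =>
    simp only [seqEval, Finset.range_zero, Finset.sum_empty, zero_add, pow_zero, one_smul]
    rfl
  | succ n ih =>
    have h := ih (CoeffBimod.app (M := iterCochain k A n) φ (b 0)) (fun i => b (i + 1))
    have e : seqEval (n + 1) ((iterCochain k A (n + 1)).r (b 0) φ) (fun i => b (i + 1)) =
        seqEval n (CoeffBimod.app (M := iterCochain k A n) φ (b 0 * b 1)) (fun i => b (i + 2)) -
        seqEval n ((iterCochain k A n).r (b 1) (CoeffBimod.app (M := iterCochain k A n) φ (b 0)))
          (fun i => b (i + 2)) := by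
      rw [← seqEval_sub]; rfl
    rw [e, h, Finset.sum_range_succ']
    have h0 : seqEval (n + 1) φ (contr 0 b) =
        seqEval n (CoeffBimod.app (M := iterCochain k A n) φ (b 0 * b 1)) (fun i => b (i + 2)) := by
      simp [seqEval, contr]
    have hj : ∀ j, seqEval (n + 1) φ (contr (j + 1) b) =
        seqEval n (CoeffBimod.app (M := iterCochain k A n) φ (b 0)) (contr j fun i => b (i + 1)) := by
      intro j
      simp only [seqEval]
      congr 1
      ext i
      simp [contr]
    have hl : seqEval (n + 1) φ b =
        seqEval n (CoeffBimod.app (M := iterCochain k A n) φ (b 0)) (fun i => b (i + 1)) := rfl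
    simp only [h0, hj, hl, pow_succ, pow_zero, mul_neg, mul_one, neg_smul, one_smul,
      Finset.sum_neg_distrib]
    abel

theorem seqEval_ext {n : ℕ} {φ ψ : iterCochain k A n} (h : ∀ b, seqEval n φ b = seqEval n ψ b) :
    φ = ψ := by
  induction n with
  | zero => exact h fun _ => 0
  | succ n ih =>
    refine CoeffBimod.shift_ext fun a => ih fun b => ?_
    -- The sequence is b with a put in front.
    exact h fun i => Nat.casesOn i a b

/-- The multilinear form of an iterated cochain. -/
theorem exists_cochain (n : ℕ) : ∃ F : iterCochain k A n →ₗ[k] Cochain k A n,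
    ∀ φ b, (F φ).toMap (fun i => b i) = seqEval n φ b := by
  induction n with
  | zero =>
    refine ⟨{ toFun := fun m => Cochain.mk (MultilinearMap.constOfIsEmpty k (fun _ : Fin 0 => A) m)
                fun _ i => i.elim0
              map_add' := fun _ _ => rfl
              map_smul' := fun _ _ => rfl }, fun φ b => rfl⟩
  | succ n ih =>
    obtain ⟨F, hF⟩ := ih
    let T : Cochain k A n →ₗ[k] MultilinearMap k (fun _ : Fin n => A) A :=
      (reducedMaps k A n).subtype
    let U : iterCochain k A (n + 1) → MultilinearMap k (fun _ : Fin (n + 1) => A) A :=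
      fun φ => LinearMap.uncurryLeft ((T.comp F).comp (CoeffBimod.app (M := iterCochain k A n) φ))
    have hU : ∀ φ a, U φ a = (F (CoeffBimod.app (M := iterCochain k A n) φ (a 0))).toMap (Fin.tail a) :=
      fun φ a => rfl
    refine ⟨{ toFun := fun φ => Cochain.mk (U φ) ?_, map_add' := ?_, map_smul' := ?_ }, ?_⟩
    · intro a i hi
      rw [hU]
      induction i using Fin.cases with
      | zero =>
        rw [hi]
        have : CoeffBimod.app (M := iterCochain k A n) φ 1 = 0 := CoeffBimod.shift_one φ
        rw [this, map_zero]
        rfl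
      | succ i => exact Cochain.mem _ _ i hi
    · intro φ ψ
      ext a
      change (F (CoeffBimod.app (M := iterCochain k A n) φ (a 0) +
        CoeffBimod.app (M := iterCochain k A n) ψ (a 0))).toMap _ = _
      rw [map_add]
      rfl
    · intro c φ
      ext a
      change (F (c • CoeffBimod.app (M := iterCochain k A n) φ (a 0))).toMap _ = _
      rw [map_smul]
      rfl
    · intro φ b
      exact hF _ fun i => b (i + 1)

/-- Every reduced cochain comes from an iterated cochain. -/
theorem exists_iterCochain (n : ℕ) : ∃ G : Cochain k A n →ₗ[k] iterCochain k A n,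
    ∀ f b, seqEval n (G f) b = f.toMap (fun i => b i) := by
  induction n with
  | zero =>
    refine ⟨{ toFun := fun f => (f.toMap (fun i => i.elim0) : A)
              map_add' := fun _ _ => rfl
              map_smul' := fun _ _ => rfl }, fun f b => ?_⟩
    change f.toMap _ = f.toMap _
    congr 1
    ext i
    exact i.elim0
  | succ n ih =>
    obtain ⟨G, hG⟩ := ih
    let S : Cochain k A (n + 1) → A →ₗ[k] Cochain k A n := fun f =>
      { toFun := fun a => Cochain.mk (f.toMap.curryLeft a) (by
          intro b i hi
          exact f.mem _ i.succ (by simpa using hi))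
        map_add' := by
          intro a b
          ext t
          exact (congrArg (fun φ => φ t) (map_add f.toMap.curryLeft a b) :)
        map_smul' := by
          intro c b
          ext t
          exact (congrArg (fun φ => φ t) (map_smul f.toMap.curryLeft c b) :) }
    have hS : ∀ f a b, (S f a).toMap b = f.toMap (Fin.cons a b) := fun _ _ _ => rfl
    refine ⟨{ toFun := fun f => CoeffBimod.ofLinear (G.comp (S f)) ?_, map_add' := ?_,
              map_smul' := ?_ }, ?_⟩
    · have : S f 1 = 0 := by
        ext b
        exact f.mem _ 0 rfl
      simp [this]
    · intro f g
      refine CoeffBimod.shift_ext fun a => ?_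
      change G (S _ a) = G (S _ a) + G (S _ a)
      rw [← map_add]
      rfl
    · intro c f
      refine CoeffBimod.shift_ext fun a => ?_
      change G (S _ a) = c • G (S _ a)
      rw [← map_smul]
      rfl
    · intro f b
      change seqEval n (G (S f (b 0))) _ = _
      rw [hG, hS]
      congr 1
      ext i
      induction i using Fin.cases <;> rfl

/-- In am - ma the left action is the first face of the Hochschild differential and the right action
supplies all the others. -/
theorem seqEval_diff (n : ℕ) (φ : iterCochain k A n) (f : Cochain k A n)
    (h : ∀ b, seqEval n φ b = f.toMap (fun i => b i)) (b : ℕ → A) :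
    seqEval (n + 1) ((iterCochain k A n).diff φ) b = (d k A n f).toMap (fun i => b i) := by
  change seqEval n ((iterCochain k A n).l (b 0) φ - (iterCochain k A n).r (b 0) φ) _ =
    dFun f.toMap _
  rw [seqEval_sub, seqEval_l, seqEval_r, dFun_seq, h]
  simp only [h, pow_succ, mul_neg, mul_one, neg_smul, Finset.sum_neg_distrib]
  abel

/-- The iterated form of a cocycle. -/
theorem exists_iterCochain_of_cocycle {n : ℕ} {f : Cochain k A n} (hf : f ∈ cocycles k A n) :
    ∃ φ : iterCochain k A n, (iterCochain k A n).diff φ = 0 ∧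
      ∀ b, seqEval n φ b = f.toMap (fun i => b i) := by
  obtain ⟨G, hG⟩ := exists_iterCochain (k := k) (A := A) n
  have hf' : d k A n f = 0 := hf
  refine ⟨G f, seqEval_ext (n := n + 1) fun b => ?_, hG f⟩
  rw [seqEval_diff n (G f) f (hG f), hf']
  exact (seqEval_zero (n + 1) b).symm

/-- A cocycle is a coboundary if its iterated form is one. -/
theorem mem_coboundaries_of_iter {n : ℕ} {f : Cochain k A (n + 1)} {φ : iterCochain k A (n + 1)}
    (hφ : ∀ b, seqEval (n + 1) φ b = f.toMap (fun i => b i))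
    (H : ∃ ψ : iterCochain k A n, (iterCochain k A n).diff ψ = φ) :
    f ∈ coboundaries k A (n + 1) := by
  obtain ⟨F, hF⟩ := exists_cochain (k := k) (A := A) n
  obtain ⟨ψ, hψ⟩ := H
  refine ⟨F ψ, ?_⟩
  ext a
  obtain ⟨b, rfl⟩ := exists_seq a
  rw [← seqEval_diff n ψ (F ψ) (fun b => (hF ψ b).symm), hψ, hφ]

end Hochschild

/-! ### Generators, direct sum decompositions and annihilators -/

namespace ISAlg

universe u

variable (k : Type u) [Field k]

/-- The generator `x`. -/
def gx : ISAlg k := RingQuot.mkAlgHom k (ISRel k) (FreeAlgebra.ι k Gen.x)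

/-- The generator `y`. -/
def gy : ISAlg k := RingQuot.mkAlgHom k (ISRel k) (FreeAlgebra.ι k Gen.y)

/-- The generator `z`. -/
def gz : ISAlg k := RingQuot.mkAlgHom k (ISRel k) (FreeAlgebra.ι k Gen.z)

/-- The sum `x + y`, for which the relations become `wx = xz = zy = 0`. -/
def gw : ISAlg k := gx k + gy k

theorem gy_eq : gy k = gw k - gx k := by simp [gw]

theorem gw_mul_gx : gw k * gx k = 0 := by
  have h := RingQuot.mkAlgHom_rel k (ISRel.xx_yx (k := k))
  simp only [map_add, map_mul, map_zero, ← add_mul] at h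
  exact h

theorem gx_mul_gz : gx k * gz k = 0 := by
  have h := RingQuot.mkAlgHom_rel k (ISRel.xz (k := k))
  simp only [map_mul, map_zero] at h
  exact h

theorem gz_mul_gy : gz k * gy k = 0 := by
  have h := RingQuot.mkAlgHom_rel k (ISRel.zy (k := k))
  simp only [map_mul, map_zero] at h
  exact h

variable {k}

/-- The universal property, in terms of the generators `w`, `x`, `z`. -/
theorem exists_algHom {B : Type*} [Ring B] [Algebra k B] (W X Z : B) (h₁ : W * X = 0)
    (h₂ : X * Z = 0) (h₃ : Z * (W - X) = 0) :
    ∃ Φ : ISAlg k →ₐ[k] B, Φ (gw k) = W ∧ Φ (gx k) = X ∧ Φ (gz k) = Z := by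
  let F : FreeAlgebra k Gen →ₐ[k] B := FreeAlgebra.lift k fun
    | .x => X
    | .y => W - X
    | .z => Z
  have hF : ∀ ⦃a b⦄, ISRel k a b → F a = F b := by
    rintro _ _ (_ | _ | _) <;> simp [F, ← add_mul, h₁, h₂, h₃]
  refine ⟨RingQuot.liftAlgHom k ⟨F, hF⟩, ?_, ?_, ?_⟩ <;>
  simp [F, gw, gx, gy, gz]

/-- Induction on elements by left multiplication with generators. -/
theorem induction_left (S : Submodule k (ISAlg k)) (h1 : 1 ∈ S)
    (hw : ∀ a ∈ S, gw k * a ∈ S) (hx : ∀ a ∈ S, gx k * a ∈ S) (hz : ∀ a ∈ S, gz k * a ∈ S)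
    (a : ISAlg k) : a ∈ S := by
  suffices H : ∀ (p : FreeAlgebra k Gen), ∀ b ∈ S, RingQuot.mkAlgHom k (ISRel k) p * b ∈ S by
    obtain ⟨p, rfl⟩ := RingQuot.mkAlgHom_surjective k (ISRel k) a
    simpa using H p 1 h1
  intro p
  induction p using FreeAlgebra.induction with
  | grade0 r =>
    intro b hb
    rw [AlgHom.commutes, ← Algebra.smul_def]
    exact S.smul_mem _ hb
  | grade1 g =>
    intro b hb
    cases g with
    | x => exact hx b hb
    | y =>
      change gy k * b ∈ S
      rw [gy_eq, sub_mul]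
      exact S.sub_mem (hw b hb) (hx b hb)
    | z => exact hz b hb
  | mul p q hp hq =>
    intro b hb
    rw [map_mul, mul_assoc]
    exact hp _ (hq b hb)
  | add p q hp hq =>
    intro b hb
    rw [map_add, add_mul]
    exact S.add_mem (hp b hb) (hq b hb)

/-- Induction on elements by right multiplication with generators. -/
theorem induction_right (S : Submodule k (ISAlg k)) (h1 : 1 ∈ S)
    (hx : ∀ a ∈ S, a * gx k ∈ S) (hy : ∀ a ∈ S, a * gy k ∈ S) (hz : ∀ a ∈ S, a * gz k ∈ S)
    (a : ISAlg k) : a ∈ S := by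
  suffices H : ∀ (p : FreeAlgebra k Gen), ∀ b ∈ S, b * RingQuot.mkAlgHom k (ISRel k) p ∈ S by
    obtain ⟨p, rfl⟩ := RingQuot.mkAlgHom_surjective k (ISRel k) a
    simpa using H p 1 h1
  intro p
  induction p using FreeAlgebra.induction with
  | grade0 r =>
    intro b hb
    rw [AlgHom.commutes, ← Algebra.commutes, ← Algebra.smul_def]
    exact S.smul_mem _ hb
  | grade1 g =>
    intro b hb
    cases g with
    | x => exact hx b hb
    | y => exact hy b hb
    | z => exact hz b hb
  | mul p q hp hq =>
    intro b hb
    rw [map_mul, ← mul_assoc]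
    exact hq _ (hp b hb)
  | add p q hp hq =>
    intro b hb
    rw [map_add, mul_add]
    exact S.add_mem (hp b hb) (hq b hb)

/-- Linear functions that control a direct sum decomposition `A = k ⊕ wA ⊕ xA ⊕ zA` with
`wA ≅ A / xA`, `xA ≅ A / zA`, `zA ≅ A / yA`. -/
theorem exists_left_decomposition :
    ∃ (c : ISAlg k →ₗ[k] k)
      (p : ISAlg k →ₗ[k] ISAlg k ⧸ LinearMap.range (LinearMap.mulLeft k (gx k)))
      (q : ISAlg k →ₗ[k] ISAlg k ⧸ LinearMap.range (LinearMap.mulLeft k (gz k)))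
      (r : ISAlg k →ₗ[k] ISAlg k ⧸ LinearMap.range (LinearMap.mulLeft k (gy k))),
      (c 1 = 1 ∧ p 1 = 0 ∧ q 1 = 0 ∧ r 1 = 0) ∧
      (∀ a, c (gw k * a) = 0 ∧ p (gw k * a) = Submodule.mkQ _ a ∧ q (gw k * a) = 0 ∧
        r (gw k * a) = 0) ∧
      (∀ a, c (gx k * a) = 0 ∧ p (gx k * a) = 0 ∧ q (gx k * a) = Submodule.mkQ _ a ∧
        r (gx k * a) = 0) ∧
      (∀ a, c (gz k * a) = 0 ∧ p (gz k * a) = 0 ∧ q (gz k * a) = 0 ∧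
        r (gz k * a) = Submodule.mkQ _ a) := by
  let X := LinearMap.range (LinearMap.mulLeft k (gx k))
  let Z := LinearMap.range (LinearMap.mulLeft k (gz k))
  let Y := LinearMap.range (LinearMap.mulLeft k (gy k))
  let N := k × (ISAlg k ⧸ X) × (ISAlg k ⧸ Z) × (ISAlg k ⧸ Y)
  let ew : (ISAlg k ⧸ X) →ₗ[k] ISAlg k := X.liftQ (LinearMap.mulLeft k (gw k)) (by
    rintro _ ⟨a, rfl⟩
    simp [← mul_assoc, gw_mul_gx])
  let ex : (ISAlg k ⧸ Z) →ₗ[k] ISAlg k := Z.liftQ (LinearMap.mulLeft k (gx k)) (by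
    rintro _ ⟨a, rfl⟩
    simp [← mul_assoc, gx_mul_gz])
  let ez : (ISAlg k ⧸ Y) →ₗ[k] ISAlg k := Y.liftQ (LinearMap.mulLeft k (gz k)) (by
    rintro _ ⟨a, rfl⟩
    simp [← mul_assoc, gz_mul_gy])
  -- The candidate inverse of the decomposition. N is made an `A`-module in which a generator acts
  -- by evaluating with e and storing the class in the slot of that generator. The quotients in N
  -- are exactly what makes the relations hold.
  let e : N →ₗ[k] ISAlg k := LinearMap.coprod (Algebra.linearMap k (ISAlg k))
    (LinearMap.coprod ew (LinearMap.coprod ex ez))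
  have he : ∀ c a b d, e (c, X.mkQ a, Z.mkQ b, Y.mkQ d) =
      algebraMap k (ISAlg k) c + (gw k * a + (gx k * b + gz k * d)) := fun _ _ _ _ => rfl
  let W' : Module.End k N := LinearMap.prod 0 (LinearMap.prod (X.mkQ.comp e) (LinearMap.prod 0 0))
  let X' : Module.End k N := LinearMap.prod 0 (LinearMap.prod 0 (LinearMap.prod (Z.mkQ.comp e) 0))
  let Z' : Module.End k N := LinearMap.prod 0 (LinearMap.prod 0 (LinearMap.prod 0 (Y.mkQ.comp e)))
  have hW' : ∀ n, W' n = (0, X.mkQ (e n), 0, 0) := fun _ => rfl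
  have hX' : ∀ n, X' n = (0, 0, Z.mkQ (e n), 0) := fun _ => rfl
  have hZ' : ∀ n, Z' n = (0, 0, 0, Y.mkQ (e n)) := fun _ => rfl
  have heW : ∀ n, e (W' n) = gw k * e n := fun n => by
    simpa [hW'] using he 0 (e n) 0 0
  have heX : ∀ n, e (X' n) = gx k * e n := fun n => by
    simpa [hX'] using he 0 0 (e n) 0
  have heZ : ∀ n, e (Z' n) = gz k * e n := fun n => by
    simpa [hZ'] using he 0 0 0 (e n)
  obtain ⟨Φ, hw, hx, hz⟩ := exists_algHom (k := k) (B := Module.End k N) W' X' Z'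
    (by
      refine LinearMap.ext fun n => ?_
      have : X.mkQ (e (X' n)) = 0 := by
        rw [heX, Submodule.mkQ_apply, Submodule.Quotient.mk_eq_zero]
        exact ⟨_, rfl⟩
      rw [Module.End.mul_apply, hW', this]
      rfl)
    (by
      refine LinearMap.ext fun n => ?_
      have : Z.mkQ (e (Z' n)) = 0 := by
        rw [heZ, Submodule.mkQ_apply, Submodule.Quotient.mk_eq_zero]
        exact ⟨_, rfl⟩
      rw [Module.End.mul_apply, hX', this]
      rfl)
    (by
      refine LinearMap.ext fun n => ?_
      have : Y.mkQ (e (W' n - X' n)) = 0 := by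
        rw [map_sub, heW, heX, ← sub_mul, ← gy_eq, Submodule.mkQ_apply,
          Submodule.Quotient.mk_eq_zero]
        exact ⟨_, rfl⟩
      rw [Module.End.mul_apply, LinearMap.sub_apply, hZ', this]
      rfl)
  -- The orbit map of the vector (1, 0, 0, 0). It is a section of e, and its components are the
  -- required functions.
  let j : ISAlg k →ₗ[k] N := (LinearMap.applyₗ (1, 0, 0, 0)).comp Φ.toLinearMap
  have j1 : j 1 = (1, 0, 0, 0) := by simp [j]
  have jw : ∀ a, j (gw k * a) = W' (j a) := fun a => by simp [j, hw]
  have jx : ∀ a, j (gx k * a) = X' (j a) := fun a => by simp [j, hx]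
  have jz : ∀ a, j (gz k * a) = Z' (j a) := fun a => by simp [j, hz]
  have ej : ∀ a, e (j a) = a := by
    intro a
    refine induction_left (LinearMap.eqLocus (e.comp j) LinearMap.id) ?_ ?_ ?_ ?_ a
    · change e (j 1) = 1
      simpa [j1] using he 1 0 0 0
    all_goals
      intro a (ha : e (j a) = a)
      change e (j _) = _
      simp only [jw, jx, jz, heW, heX, heZ, ha, LinearMap.id_apply]
  refine ⟨(LinearMap.fst k k _).comp j, (LinearMap.fst k _ _).comp ((LinearMap.snd k k _).comp j),
    (LinearMap.fst k _ _).comp ((LinearMap.snd k _ _).comp ((LinearMap.snd k k _).comp j)),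
    (LinearMap.snd k _ _).comp ((LinearMap.snd k _ _).comp ((LinearMap.snd k k _).comp j)),
    ?_, fun a => ?_, fun a => ?_, fun a => ?_⟩
  · simp [j1]
  · simp only [LinearMap.comp_apply, jw, hW', ej]
    exact ⟨rfl, rfl, rfl, rfl⟩
  · simp only [LinearMap.comp_apply, jx, hX', ej]
    exact ⟨rfl, rfl, rfl, rfl⟩
  · simp only [LinearMap.comp_apply, jz, hZ', ej]
    exact ⟨rfl, rfl, rfl, rfl⟩

/-- Linear functions that control a direct sum decomposition `A = k ⊕ Ax ⊕ Ay ⊕ Az` with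
`Ax ≅ A / Aw`, `Ay ≅ A / Az`, `Az ≅ A / Ax`. -/
theorem exists_right_decomposition :
    ∃ (c : ISAlg k →ₗ[k] k)
      (p : ISAlg k →ₗ[k] ISAlg k ⧸ LinearMap.range (LinearMap.mulRight k (gw k)))
      (q : ISAlg k →ₗ[k] ISAlg k ⧸ LinearMap.range (LinearMap.mulRight k (gz k)))
      (r : ISAlg k →ₗ[k] ISAlg k ⧸ LinearMap.range (LinearMap.mulRight k (gx k))),
      (c 1 = 1 ∧ p 1 = 0 ∧ q 1 = 0 ∧ r 1 = 0) ∧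
      (∀ a, c (a * gx k) = 0 ∧ p (a * gx k) = Submodule.mkQ _ a ∧ q (a * gx k) = 0 ∧
        r (a * gx k) = 0) ∧
      (∀ a, c (a * gy k) = 0 ∧ p (a * gy k) = 0 ∧ q (a * gy k) = Submodule.mkQ _ a ∧
        r (a * gy k) = 0) ∧
      (∀ a, c (a * gz k) = 0 ∧ p (a * gz k) = 0 ∧ q (a * gz k) = 0 ∧
        r (a * gz k) = Submodule.mkQ _ a) := by
  let W := LinearMap.range (LinearMap.mulRight k (gw k))
  let Z := LinearMap.range (LinearMap.mulRight k (gz k))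
  let X := LinearMap.range (LinearMap.mulRight k (gx k))
  let N := k × (ISAlg k ⧸ W) × (ISAlg k ⧸ Z) × (ISAlg k ⧸ X)
  let ex : (ISAlg k ⧸ W) →ₗ[k] ISAlg k := W.liftQ (LinearMap.mulRight k (gx k)) (by
    rintro _ ⟨a, rfl⟩
    simp [mul_assoc, gw_mul_gx])
  let ey : (ISAlg k ⧸ Z) →ₗ[k] ISAlg k := Z.liftQ (LinearMap.mulRight k (gy k)) (by
    rintro _ ⟨a, rfl⟩
    simp [mul_assoc, gz_mul_gy])
  let ez : (ISAlg k ⧸ X) →ₗ[k] ISAlg k := X.liftQ (LinearMap.mulRight k (gz k)) (by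
    rintro _ ⟨a, rfl⟩
    simp [mul_assoc, gx_mul_gz])
  let e : N →ₗ[k] ISAlg k := LinearMap.coprod (Algebra.linearMap k (ISAlg k))
    (LinearMap.coprod ex (LinearMap.coprod ey ez))
  have he : ∀ c a b d, e (c, W.mkQ a, Z.mkQ b, X.mkQ d) =
      algebraMap k (ISAlg k) c + (a * gx k + (b * gy k + d * gz k)) := fun _ _ _ _ => rfl
  let X' : Module.End k N := LinearMap.prod 0 (LinearMap.prod (W.mkQ.comp e) (LinearMap.prod 0 0))
  let Y' : Module.End k N := LinearMap.prod 0 (LinearMap.prod 0 (LinearMap.prod (Z.mkQ.comp e) 0))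
  let Z' : Module.End k N := LinearMap.prod 0 (LinearMap.prod 0 (LinearMap.prod 0 (X.mkQ.comp e)))
  have hX' : ∀ n, X' n = (0, W.mkQ (e n), 0, 0) := fun _ => rfl
  have hY' : ∀ n, Y' n = (0, 0, Z.mkQ (e n), 0) := fun _ => rfl
  have hZ' : ∀ n, Z' n = (0, 0, 0, X.mkQ (e n)) := fun _ => rfl
  have heX : ∀ n, e (X' n) = e n * gx k := fun n => by
    simpa [hX'] using he 0 (e n) 0 0
  have heY : ∀ n, e (Y' n) = e n * gy k := fun n => by
    simpa [hY'] using he 0 0 (e n) 0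
  have heZ : ∀ n, e (Z' n) = e n * gz k := fun n => by
    simpa [hZ'] using he 0 0 0 (e n)
  -- Right multiplication reverses products, hence the opposite algebra. The slots now belong to x,
  -- y, z, so w acts by the sum of the operators of x and y.
  obtain ⟨Φ, hw, hx, hz⟩ := exists_algHom (k := k) (B := (Module.End k N)ᵐᵒᵖ)
    (MulOpposite.op (X' + Y')) (MulOpposite.op X') (MulOpposite.op Z')
    (by
      rw [← MulOpposite.op_mul, MulOpposite.op_eq_zero_iff]
      refine LinearMap.ext fun n => ?_
      have : W.mkQ (e (X' n + Y' n)) = 0 := by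
        rw [map_add, heX, heY, ← mul_add, Submodule.mkQ_apply, Submodule.Quotient.mk_eq_zero]
        exact ⟨_, rfl⟩
      rw [Module.End.mul_apply, LinearMap.add_apply, hX', this]
      rfl)
    (by
      rw [← MulOpposite.op_mul, MulOpposite.op_eq_zero_iff]
      refine LinearMap.ext fun n => ?_
      have : X.mkQ (e (X' n)) = 0 := by
        rw [heX, Submodule.mkQ_apply, Submodule.Quotient.mk_eq_zero]
        exact ⟨_, rfl⟩
      rw [Module.End.mul_apply, hZ', this]
      rfl)
    (by
      rw [← MulOpposite.op_sub, ← MulOpposite.op_mul, MulOpposite.op_eq_zero_iff,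
        add_sub_cancel_left]
      refine LinearMap.ext fun n => ?_
      have : Z.mkQ (e (Z' n)) = 0 := by
        rw [heZ, Submodule.mkQ_apply, Submodule.Quotient.mk_eq_zero]
        exact ⟨_, rfl⟩
      rw [Module.End.mul_apply, hY', this]
      rfl)
  have hy : Φ (gy k) = MulOpposite.op Y' := by
    rw [gy_eq, map_sub, hw, hx, ← MulOpposite.op_sub, add_sub_cancel_left]
  let j : ISAlg k →ₗ[k] N := (LinearMap.applyₗ (1, 0, 0, 0)).comp
    ((MulOpposite.opLinearEquiv k).symm.toLinearMap.comp Φ.toLinearMap)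
  have j1 : j 1 = (1, 0, 0, 0) := by simp [j]
  have jx : ∀ a, j (a * gx k) = X' (j a) := fun a => by simp [j, hx]
  have jy : ∀ a, j (a * gy k) = Y' (j a) := fun a => by simp [j, hy]
  have jz : ∀ a, j (a * gz k) = Z' (j a) := fun a => by simp [j, hz]
  have ej : ∀ a, e (j a) = a := by
    intro a
    refine induction_right (LinearMap.eqLocus (e.comp j) LinearMap.id) ?_ ?_ ?_ ?_ a
    · change e (j 1) = 1
      simpa [j1] using he 1 0 0 0
    all_goals
      intro a (ha : e (j a) = a)
      change e (j _) = _
      simp only [jx, jy, jz, heX, heY, heZ, ha, LinearMap.id_apply]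
  refine ⟨(LinearMap.fst k k _).comp j, (LinearMap.fst k _ _).comp ((LinearMap.snd k k _).comp j),
    (LinearMap.fst k _ _).comp ((LinearMap.snd k _ _).comp ((LinearMap.snd k k _).comp j)),
    (LinearMap.snd k _ _).comp ((LinearMap.snd k _ _).comp ((LinearMap.snd k k _).comp j)),
    ?_, fun a => ?_, fun a => ?_, fun a => ?_⟩
  · simp [j1]
  · simp only [LinearMap.comp_apply, jx, hX', ej]
    exact ⟨rfl, rfl, rfl, rfl⟩
  · simp only [LinearMap.comp_apply, jy, hY', ej]
    exact ⟨rfl, rfl, rfl, rfl⟩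
  · simp only [LinearMap.comp_apply, jz, hZ', ej]
    exact ⟨rfl, rfl, rfl, rfl⟩

/-- `A = k + wA + xA + zA`. -/
theorem exists_left_eq (a : ISAlg k) : ∃ (c : k) (p q r : ISAlg k),
    a = algebraMap k _ c + gw k * p + gx k * q + gz k * r := by
  let S : Submodule k (ISAlg k) := (LinearMap.range (Algebra.linearMap k (ISAlg k))) ⊔
    LinearMap.range (LinearMap.mulLeft k (gw k)) ⊔ LinearMap.range (LinearMap.mulLeft k (gx k)) ⊔
    LinearMap.range (LinearMap.mulLeft k (gz k))
  have h : a ∈ S := by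
    refine induction_left S ?_ ?_ ?_ ?_ a
    · exact (le_sup_left.trans (le_sup_left.trans le_sup_left) :
        LinearMap.range (Algebra.linearMap k (ISAlg k)) ≤ S) ⟨1, by simp⟩
    · exact fun b _ => (le_sup_right.trans (le_sup_left.trans le_sup_left) :
        LinearMap.range (LinearMap.mulLeft k (gw k)) ≤ S) ⟨b, rfl⟩
    · exact fun b _ => (le_sup_right.trans le_sup_left :
        LinearMap.range (LinearMap.mulLeft k (gx k)) ≤ S) ⟨b, rfl⟩
    · exact fun b _ => (le_sup_right : LinearMap.range (LinearMap.mulLeft k (gz k)) ≤ S) ⟨b, rfl⟩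
  obtain ⟨_, h₁, _, ⟨r, rfl⟩, e₁⟩ := Submodule.mem_sup.1 h
  obtain ⟨_, h₂, _, ⟨q, rfl⟩, e₂⟩ := Submodule.mem_sup.1 h₁
  obtain ⟨_, ⟨c, rfl⟩, _, ⟨p, rfl⟩, e₃⟩ := Submodule.mem_sup.1 h₂
  exact ⟨c, p, q, r, by rw [← e₁, ← e₂, ← e₃]; rfl⟩

/-- `A = k + Ax + Ay + Az`. -/
theorem exists_right_eq (a : ISAlg k) : ∃ (c : k) (p q r : ISAlg k),
    a = algebraMap k _ c + p * gx k + q * gy k + r * gz k := by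
  let S : Submodule k (ISAlg k) := (LinearMap.range (Algebra.linearMap k (ISAlg k))) ⊔
    LinearMap.range (LinearMap.mulRight k (gx k)) ⊔ LinearMap.range (LinearMap.mulRight k (gy k)) ⊔
    LinearMap.range (LinearMap.mulRight k (gz k))
  have h : a ∈ S := by
    refine induction_right S ?_ ?_ ?_ ?_ a
    · exact (le_sup_left.trans (le_sup_left.trans le_sup_left) :
        LinearMap.range (Algebra.linearMap k (ISAlg k)) ≤ S) ⟨1, by simp⟩
    · exact fun b _ => (le_sup_right.trans (le_sup_left.trans le_sup_left) :
        LinearMap.range (LinearMap.mulRight k (gx k)) ≤ S) ⟨b, rfl⟩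
    · exact fun b _ => (le_sup_right.trans le_sup_left :
        LinearMap.range (LinearMap.mulRight k (gy k)) ≤ S) ⟨b, rfl⟩
    · exact fun b _ => (le_sup_right : LinearMap.range (LinearMap.mulRight k (gz k)) ≤ S) ⟨b, rfl⟩
  obtain ⟨_, h₁, _, ⟨r, rfl⟩, e₁⟩ := Submodule.mem_sup.1 h
  obtain ⟨_, h₂, _, ⟨q, rfl⟩, e₂⟩ := Submodule.mem_sup.1 h₁
  obtain ⟨_, ⟨c, rfl⟩, _, ⟨p, rfl⟩, e₃⟩ := Submodule.mem_sup.1 h₂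
  exact ⟨c, p, q, r, by rw [← e₁, ← e₂, ← e₃]; rfl⟩

/-- The sum `k + wA + xA + zA` is direct, and its terms are as small as the relations permit. -/
theorem left_independent {c : k} {p q r : ISAlg k}
    (h : algebraMap k _ c + gw k * p + gx k * q + gz k * r = 0) :
    c = 0 ∧ (∃ s, p = gx k * s) ∧ (∃ s, q = gz k * s) ∧ ∃ s, r = gy k * s := by
  obtain ⟨C, P, Q, R, ⟨h1, h2, h3, h4⟩, hw, hx, hz⟩ := exists_left_decomposition (k := k)
  rw [Algebra.algebraMap_eq_smul_one] at h
  refine ⟨?_, ?_, ?_, ?_⟩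
  · simpa [h1, hw, hx, hz] using congrArg C h
  · obtain ⟨s, hs⟩ : ∃ s, _ = p := by simpa [h2, hw, hx, hz] using congrArg P h
    exact ⟨s, hs.symm⟩
  · obtain ⟨s, hs⟩ : ∃ s, _ = q := by simpa [h3, hw, hx, hz] using congrArg Q h
    exact ⟨s, hs.symm⟩
  · obtain ⟨s, hs⟩ : ∃ s, _ = r := by simpa [h4, hw, hx, hz] using congrArg R h
    exact ⟨s, hs.symm⟩

/-- The sum `k + Ax + Ay + Az` is direct, and its terms are as small as the relations permit. -/
theorem right_independent {c : k} {p q r : ISAlg k}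
    (h : algebraMap k _ c + p * gx k + q * gy k + r * gz k = 0) :
    c = 0 ∧ (∃ s, p = s * gw k) ∧ (∃ s, q = s * gz k) ∧ ∃ s, r = s * gx k := by
  obtain ⟨C, P, Q, R, ⟨h1, h2, h3, h4⟩, hx, hy, hz⟩ := exists_right_decomposition (k := k)
  rw [Algebra.algebraMap_eq_smul_one] at h
  refine ⟨?_, ?_, ?_, ?_⟩
  · simpa [h1, hx, hy, hz] using congrArg C h
  · obtain ⟨s, hs⟩ : ∃ s, _ = p := by simpa [h2, hx, hy, hz] using congrArg P h
    exact ⟨s, hs.symm⟩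
  · obtain ⟨s, hs⟩ : ∃ s, _ = q := by simpa [h3, hx, hy, hz] using congrArg Q h
    exact ⟨s, hs.symm⟩
  · obtain ⟨s, hs⟩ : ∃ s, _ = r := by simpa [h4, hx, hy, hz] using congrArg R h
    exact ⟨s, hs.symm⟩

theorem left_direct {c : k} {p q r : ISAlg k}
    (h : algebraMap k _ c + gw k * p + gx k * q + gz k * r = 0) :
    c = 0 ∧ gw k * p = 0 ∧ gx k * q = 0 ∧ gz k * r = 0 := by
  obtain ⟨hc, ⟨s, rfl⟩, ⟨t, rfl⟩, u, rfl⟩ := left_independent h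
  simp [hc, ← mul_assoc, gw_mul_gx, gx_mul_gz, gz_mul_gy]

theorem right_direct {c : k} {p q r : ISAlg k}
    (h : algebraMap k _ c + p * gx k + q * gy k + r * gz k = 0) :
    c = 0 ∧ p * gx k = 0 ∧ q * gy k = 0 ∧ r * gz k = 0 := by
  obtain ⟨hc, ⟨s, rfl⟩, ⟨t, rfl⟩, u, rfl⟩ := right_independent h
  simp [hc, mul_assoc, gw_mul_gx, gx_mul_gz, gz_mul_gy]

theorem gw_mul_eq_zero {a : ISAlg k} (h : gw k * a = 0) : ∃ s, a = gx k * s :=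
  (left_independent (c := 0) (p := a) (q := 0) (r := 0) (by simp [h])).2.1

theorem gx_mul_eq_zero {a : ISAlg k} (h : gx k * a = 0) : ∃ s, a = gz k * s :=
  (left_independent (c := 0) (p := 0) (q := a) (r := 0) (by simp [h])).2.2.1

theorem gz_mul_eq_zero {a : ISAlg k} (h : gz k * a = 0) : ∃ s, a = gy k * s :=
  (left_independent (c := 0) (p := 0) (q := 0) (r := a) (by simp [h])).2.2.2

/-- Since ya = wa - xa, directness makes a a member of both xA and zA, which meet in 0. -/
theorem gy_mul_eq_zero {a : ISAlg k} (h : gy k * a = 0) : a = 0 := by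
  rw [gy_eq, sub_mul, sub_eq_add_neg, ← mul_neg] at h
  obtain ⟨-, ⟨s, rfl⟩, ⟨t, ht⟩, -⟩ :=
    left_independent (c := 0) (p := a) (q := -a) (r := 0)
      (by simpa only [map_zero, mul_zero, zero_add, add_zero] using h)
  have := (left_direct (c := 0) (p := 0) (q := s) (r := t) (by simp [← ht])).2.2.1
  exact this

theorem mul_gx_eq_zero {a : ISAlg k} (h : a * gx k = 0) : ∃ s, a = s * gw k :=
  (right_independent (c := 0) (p := a) (q := 0) (r := 0) (by simp [h])).2.1

theorem mul_gy_eq_zero {a : ISAlg k} (h : a * gy k = 0) : ∃ s, a = s * gz k :=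
  (right_independent (c := 0) (p := 0) (q := a) (r := 0) (by simp [h])).2.2.1

theorem mul_gz_eq_zero {a : ISAlg k} (h : a * gz k = 0) : ∃ s, a = s * gx k :=
  (right_independent (c := 0) (p := 0) (q := 0) (r := a) (by simp [h])).2.2.2

/-- Since aw = ax + ay, directness gives a = sw = tz. Then sx + sy = tz, and directness again kills
sx and sy, hence a. -/
theorem mul_gw_eq_zero {a : ISAlg k} (h : a * gw k = 0) : a = 0 := by
  rw [gw, mul_add] at h
  obtain ⟨-, ⟨s, rfl⟩, ⟨t, ht⟩, -⟩ :=
    right_independent (c := 0) (p := a) (q := a) (r := 0) (by simpa using h)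
  obtain ⟨-, h1, h2, -⟩ := right_direct (c := 0) (p := s) (q := s) (r := -t)
    (by
      have e : -t * gz k = -(t * gz k) := neg_mul t (gz k)
      rw [e, ← ht, gw, mul_add, map_zero, zero_add, add_neg_cancel])
  rw [gw, mul_add, h1, h2, add_zero]

end ISAlg

/-! ### Cocycles are governed by their values at the segments of wxzy -/

namespace ISAlg

open Hochschild

universe u

variable {k : Type u} [Field k]

/-- This identifies the first coordinate of the twisted modules A × M and A × M⁴ used below with the
left regular module. -/
theorem map_algHom_apply {S : Type*} [AddCommGroup S] [Module k S]
    (Φ : ISAlg k →ₐ[k] Module.End k S) (p : S →ₗ[k] ISAlg k)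
    (hw : ∀ s, p (Φ (gw k) s) = gw k * p s) (hx : ∀ s, p (Φ (gx k) s) = gx k * p s)
    (hz : ∀ s, p (Φ (gz k) s) = gz k * p s) (a : ISAlg k) (s : S) : p (Φ a s) = a * p s := by
  refine induction_left (LinearMap.eqLocus (p.comp ((LinearMap.applyₗ s).comp Φ.toLinearMap))
    (LinearMap.mulRight k (p s))) ?_ ?_ ?_ ?_ a
  · simp
  all_goals
    intro a (ha : p (Φ a s) = a * p s)
    change p (Φ _ s) = _ * _ * p s
    simp [hw, hx, hz, ha, mul_assoc]

/-- The augmentation. -/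
theorem exists_augmentation : ∃ c : ISAlg k →ₗ[k] k, c 1 = 1 ∧ (∀ a, c (gw k * a) = 0) ∧
    (∀ a, c (gx k * a) = 0) ∧ (∀ a, c (gz k * a) = 0) := by
  obtain ⟨C, P, Q, R, ⟨h1, -⟩, hw, hx, hz⟩ := exists_left_decomposition (k := k)
  exact ⟨C, h1, fun a => (hw a).1, fun a => (hx a).1, fun a => (hz a).1⟩

/-- The projection onto `xA` along `k ⊕ wA ⊕ zA`. -/
theorem exists_projection : ∃ π : ISAlg k →ₗ[k] ISAlg k, π 1 = 0 ∧ (∀ a, π (gw k * a) = 0) ∧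
    (∀ a, π (gx k * a) = gx k * a) ∧ (∀ a, π (gz k * a) = 0) := by
  obtain ⟨C, P, Q, R, ⟨-, -, h1, -⟩, hw, hx, hz⟩ := exists_left_decomposition (k := k)
  refine ⟨(Submodule.liftQ _ (LinearMap.mulLeft k (gx k)) (by
    rintro _ ⟨a, rfl⟩
    simp [← mul_assoc, gx_mul_gz])).comp Q, ?_, fun a => ?_, fun a => ?_, fun a => ?_⟩
  · simp [h1]
  · simp [hw]
  · simp [hx]
  · simp [hz]

/-- An element of `M.shift` may have any values at the generators. -/
theorem exists_shift {M : CoeffBimod k (ISAlg k)} (m₁ m₂ m₃ : M) :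
    ∃ g : M.shift, g (gw k) = m₁ ∧ g (gx k) = m₂ ∧ g (gz k) = m₃ := by
  obtain ⟨C, P, Q, R, ⟨h1, h2, h3, h4⟩, hw, hx, hz⟩ := exists_left_decomposition (k := k)
  -- The three functionals read off the coefficients of w, x and z. They descend to the quotients
  -- because the augmentation kills xA, zA and yA.
  let c₁ := (Submodule.liftQ _ C (by rintro _ ⟨a, rfl⟩; simp [hx])).comp P
  let c₂ := (Submodule.liftQ _ C (by rintro _ ⟨a, rfl⟩; simp [hz])).comp Q
  let c₃ := (Submodule.liftQ _ C (by
    rintro _ ⟨a, rfl⟩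
    simp [gy_eq, sub_mul, hw, hx])).comp R
  refine ⟨CoeffBimod.ofLinear (c₁.smulRight m₁ + c₂.smulRight m₂ + c₃.smulRight m₃)
    (by simp [c₁, c₂, c₃, h2, h3, h4]), ?_, ?_, ?_⟩
  · have h := hw 1
    rw [mul_one] at h
    simp [c₁, c₂, c₃, h, h1]
  · have h := hx 1
    rw [mul_one] at h
    simp [c₁, c₂, c₃, h, h1]
  · have h := hz 1
    rw [mul_one] at h
    simp [c₁, c₂, c₃, h, h1]

/-- An element of `M.shift` may be prescribed on a right ideal `vA` of the augmentation ideal. -/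
theorem exists_shift_mul {M : CoeffBimod k (ISAlg k)} (v : ISAlg k) (φ : ISAlg k →ₗ[k] M)
    {c : ISAlg k →ₗ[k] k} (hc : c 1 = 1) (hv : ∀ a, c (v * a) = 0)
    (hφ : ∀ a, v * a = 0 → φ a = 0) :
    ∃ g : M.shift, ∀ a, g (v * a) = φ a := by
  let μ := LinearMap.mulLeft k v
  obtain ⟨ψ, hψ⟩ := LinearMap.exists_extend
    (((LinearMap.ker μ).liftQ φ fun a ha => hφ a ha).comp μ.quotKerEquivRange.symm.toLinearMap)
  have hψ' : ∀ a, ψ (v * a) = φ a := by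
    intro a
    have h := LinearMap.congr_fun hψ (μ.quotKerEquivRange (Submodule.Quotient.mk a))
    simp only [LinearMap.comp_apply, LinearEquiv.coe_coe, LinearEquiv.symm_apply_apply] at h
    exact h
  -- The correction makes the value at 1 vanish and leaves vA untouched, since c kills vA.
  exact ⟨CoeffBimod.ofLinear (ψ - c.smulRight (ψ 1)) (by simp [hc]), fun a => by simp [hψ', hv]⟩

variable {M : CoeffBimod k (ISAlg k)}

/-- A derivation is determined by its values at the generators. -/
theorem derivation_eq_zero {f : M.shift} (hf : M.shift.diff f = 0) (hw : f (gw k) = 0)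
    (hx : f (gx k) = 0) (hz : f (gz k) = 0) : f = 0 := by
  have h : ∀ a b, f (a * b) = M.l a (f b) + M.r b (f a) := by
    intro a b
    have h : (M.shift.diff f) a b = 0 := by rw [hf]; simp
    simp only [CoeffBimod.diff_app, map_sub, LinearMap.sub_apply, CoeffBimod.shift_l,
      CoeffBimod.shift_r] at h
    rw [← sub_eq_zero, ← neg_eq_zero, ← h]
    abel
  refine CoeffBimod.shift_ext fun a => ?_
  change _ = (0 : M)
  refine induction_left (LinearMap.ker (CoeffBimod.app f)) (CoeffBimod.shift_one f) ?_ ?_ ?_ a <;>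
  · intro a (ha : f a = 0)
    change f _ = 0
    simp [h, hw, hx, hz, ha]

/-- A 2-cocycle describes an extension of the left module `A` by M. Its vanishing at wx, xz, zy lets
the generators act on A × M, and the orbit of (1, 0) is the graph of a primitive. -/
theorem exists_primitive_two {f : M.shift.shift} (hf : M.shift.shift.diff f = 0)
    (hwx : f (gw k) (gx k) = 0) (hxz : f (gx k) (gz k) = 0) (hzy : f (gz k) (gy k) = 0) :
    ∃ h : M.shift, M.shift.diff h = f := by
  have H : ∀ a b c, M.l a (f b c) - f (a * b) c + f a (b * c) - M.r c (f a b) = 0 := by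
    intro a b c
    have h : (M.shift.shift.diff f) a b c = 0 := by rw [hf]; simp
    simp only [CoeffBimod.diff_app, map_sub, LinearMap.sub_apply, CoeffBimod.shift_l,
      CoeffBimod.shift_r] at h
    rw [← h]
    abel
  -- The action of v twisted by f. By the cocycle identity T u T v = 0 as soon as uv = 0 and f(u, v)
  -- = 0.
  let T : ISAlg k →ₗ[k] Module.End k (ISAlg k × M) :=
    { toFun := fun v => LinearMap.prod ((LinearMap.mulLeft k v).comp (LinearMap.fst k _ _))
        ((M.l v).comp (LinearMap.snd k _ _) - (CoeffBimod.app (f v)).comp (LinearMap.fst k _ _))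
      map_add' := by intros; ext <;> simp [add_mul]; abel
      map_smul' := by intros; ext <;> simp }
  have hT : ∀ v a m, T v (a, m) = (v * a, M.l v m - f v a) := fun _ _ _ => rfl
  have hTT : ∀ u v, u * v = 0 → f u v = 0 → T u * T v = 0 := by
    intro u v huv hf0
    refine LinearMap.ext fun ⟨a, m⟩ => ?_
    rw [Module.End.mul_apply, hT, hT, ← mul_assoc, huv, zero_mul, map_sub, ← M.l_mul, huv]
    have h := H u v a
    rw [hf0, huv] at h
    simp only [map_zero, LinearMap.zero_apply, sub_zero] at h
    ext
    · rfl
    · simp only [map_zero, LinearMap.zero_apply, zero_sub, Prod.snd_zero]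
      rw [← neg_eq_zero, ← h]
      abel
  obtain ⟨Φ, hw, hx, hz⟩ := exists_algHom (k := k) (B := Module.End k (ISAlg k × M))
    (T (gw k)) (T (gx k)) (T (gz k)) (hTT _ _ (gw_mul_gx k) hwx) (hTT _ _ (gx_mul_gz k) hxz)
    (by
      have e : T (gy k) = T (gw k) - T (gx k) := by rw [gy_eq]; exact map_sub T _ _
      rw [← e]
      exact hTT _ _ (gz_mul_gy k) hzy)
  have h1 : ∀ a, (Φ a (1, 0)).1 = a := by
    intro a
    have h := map_algHom_apply Φ (LinearMap.fst k _ _) (by rw [hw]; exact fun _ => rfl)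
      (by rw [hx]; exact fun _ => rfl) (by rw [hz]; exact fun _ => rfl) a (1, 0)
    simpa using h
  let g : M.shift := CoeffBimod.ofLinear ((LinearMap.snd k _ _).comp
      ((LinearMap.applyₗ (1, 0)).comp Φ.toLinearMap)) (by simp)
  have hg : ∀ v a, Φ v = T v → g (v * a) = M.l v (g a) - f v a := by
    intro v a hv
    change (Φ (v * a) (1, 0)).2 = _
    rw [map_mul, Module.End.mul_apply, hv]
    change _ - f v (Φ a (1, 0)).1 = _
    rw [h1]
    rfl
  have hgv : ∀ v, Φ v = T v → (f - M.shift.diff g) v = 0 := by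
    intro v hv
    have e := hg v 1 hv
    rw [mul_one, CoeffBimod.shift_one, CoeffBimod.shift_one, map_zero, sub_zero] at e
    refine CoeffBimod.shift_ext fun a => ?_
    simp only [CoeffBimod.diff_app, map_sub, LinearMap.sub_apply, CoeffBimod.shift_l,
      CoeffBimod.shift_r, map_zero,
      LinearMap.zero_apply, hg v a hv, e]
    abel
  -- The difference f - dg is a derivation with values in `M.shift` that vanishes at the generators.
  refine ⟨g, (sub_eq_zero.1 (derivation_eq_zero ?_ (hgv _ hw) (hgv _ hx) (hgv _ hz))).symm⟩
  rw [map_sub, hf, CoeffBimod.diff_diff, sub_zero]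

theorem cocycle_three {f : M.shift.shift.shift} (hf : M.shift.shift.shift.diff f = 0)
    (a b c d : ISAlg k) : M.l a (f b c d) - f (a * b) c d + f a (b * c) d - f a b (c * d) +
      M.r d (f a b c) = 0 := by
  have h : (M.shift.shift.shift.diff f) a b c d = 0 := by rw [hf]; simp
  simp only [CoeffBimod.diff_app, map_sub, LinearMap.sub_apply, CoeffBimod.shift_l,
    CoeffBimod.shift_r] at h
  rw [← h]
  abel

/-- The three equations say that the 2-cochain with values gw', gx', gz' at w, x, z has coboundary f
on arguments beginning with wx, xz, zy. They form a simultaneous recursion on the length of a, whose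
consistency is the cocycle identity at wxz and xzy. -/
theorem exists_partial_primitive_three {f : M.shift.shift.shift}
    (hf : M.shift.shift.shift.diff f = 0) (hwxz : f (gw k) (gx k) (gz k) = 0)
    (hxzy : f (gx k) (gz k) (gy k) = 0) :
    ∃ gw' gx' gz' : M.shift,
      (∀ a, gw' (gx k * a) = f (gw k) (gx k) a - M.l (gw k) (gx' a)) ∧
      (∀ a, gx' (gz k * a) = f (gx k) (gz k) a - M.l (gx k) (gz' a)) ∧
      (∀ a, gz' (gy k * a) = f (gz k) (gy k) a - M.l (gz k) (gw' a - gx' a)) := by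
  have H₁ : ∀ a, f (gw k) (gx k) (gz k * a) = M.l (gw k) (f (gx k) (gz k) a) := by
    intro a
    have h := cocycle_three hf (gw k) (gx k) (gz k) a
    simp only [gw_mul_gx, gx_mul_gz, hwxz, map_zero, LinearMap.zero_apply,
      sub_zero, add_zero, sub_eq_zero] at h
    exact h.symm
  have H₂ : ∀ a, f (gx k) (gz k) (gy k * a) = M.l (gx k) (f (gz k) (gy k) a) := by
    intro a
    have h := cocycle_three hf (gx k) (gz k) (gy k) a
    simp only [gz_mul_gy, gx_mul_gz, hxzy, map_zero, LinearMap.zero_apply,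
      sub_zero, add_zero, sub_eq_zero] at h
    exact h.symm
  have L₁ : ∀ m, M.l (gw k) (M.l (gx k) m) = 0 := fun m => by rw [← M.l_mul, gw_mul_gx]; simp
  have L₂ : ∀ m, M.l (gx k) (M.l (gz k) m) = 0 := fun m => by rw [← M.l_mul, gx_mul_gz]; simp
  obtain ⟨π, -, hπw, hπx, hπz⟩ := exists_projection (k := k)
  -- A state is (a; gw'(a), gx'(a), u, v) with gz'(a) = u - v. The prescription of gz' on ya has to
  -- be distributed over wa and xa. The projection π onto xA splits f(z, y, a) so that the share of
  -- wa vanishes for a in xA and the share of xa vanishes for a in zA, as wx = 0 and xz = 0 demand.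
  let W' : Module.End k (ISAlg k × M × M × M × M) :=
    { toFun := fun s => (gw k * s.1, 0, 0,
        f (gz k) (gy k) (s.1 - π s.1) + M.l (gz k) s.2.2.1, 0)
      map_add' := by intros; ext <;> simp [mul_add]; abel
      map_smul' := by intros; ext <;> simp [smul_sub, smul_add] }
  let X' : Module.End k (ISAlg k × M × M × M × M) :=
    { toFun := fun s => (gx k * s.1, f (gw k) (gx k) s.1 - M.l (gw k) s.2.2.1, 0, 0,
        f (gz k) (gy k) (π s.1) - M.l (gz k) s.2.1)
      map_add' := by intros; ext <;> simp [mul_add] <;> abel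
      map_smul' := by intros; ext <;> simp [smul_sub] }
  let Z' : Module.End k (ISAlg k × M × M × M × M) :=
    { toFun := fun s => (gz k * s.1, 0,
        f (gx k) (gz k) s.1 - M.l (gx k) (s.2.2.2.1 - s.2.2.2.2), 0, 0)
      map_add' := by intros; ext <;> simp [mul_add]; abel
      map_smul' := by intros; ext <;> simp [smul_sub] }
  have hW' : ∀ s, W' s = (gw k * s.1, 0, 0,
        f (gz k) (gy k) (s.1 - π s.1) + M.l (gz k) s.2.2.1, 0) := fun _ => rfl
  have hX' : ∀ s, X' s = (gx k * s.1, f (gw k) (gx k) s.1 - M.l (gw k) s.2.2.1, 0, 0,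
        f (gz k) (gy k) (π s.1) - M.l (gz k) s.2.1) := fun _ => rfl
  have hZ' : ∀ s, Z' s = (gz k * s.1, 0,
        f (gx k) (gz k) s.1 - M.l (gx k) (s.2.2.2.1 - s.2.2.2.2), 0, 0) := fun _ => rfl
  obtain ⟨Φ, hw, hx, hz⟩ := exists_algHom (k := k) (B := Module.End k (ISAlg k × M × M × M × M)) W' X' Z'
    (by
      refine LinearMap.ext fun s => ?_
      rw [Module.End.mul_apply, hX', hW']
      simp only [← mul_assoc, gw_mul_gx, zero_mul, hπx, sub_self, map_zero, add_zero]
      rfl)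
    (by
      refine LinearMap.ext fun s => ?_
      rw [Module.End.mul_apply, hZ', hX']
      simp only [← mul_assoc, gx_mul_gz, zero_mul, hπz, map_sub, H₁, L₁, sub_self, map_zero,
        sub_zero]
      rfl)
    (by
      refine LinearMap.ext fun s => ?_
      rw [Module.End.mul_apply, LinearMap.sub_apply, hW', hX', hZ']
      simp only [Prod.fst_sub, Prod.snd_sub, ← sub_mul, ← gy_eq, ← mul_assoc, gz_mul_gy, zero_mul,
        H₂, map_sub, map_add, L₂, sub_zero, zero_sub, add_zero]
      ext <;> simp [L₂])
  have h1 : ∀ a, (Φ a (1, 0)).1 = a := by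
    intro a
    have h := map_algHom_apply Φ (LinearMap.fst k _ _) (by rw [hw]; exact fun _ => rfl)
      (by rw [hx]; exact fun _ => rfl) (by rw [hz]; exact fun _ => rfl) a (1, 0)
    simpa using h
  let E : ISAlg k →ₗ[k] M × M × M × M :=
    (LinearMap.snd k _ _).comp ((LinearMap.applyₗ (1, 0)).comp Φ.toLinearMap)
  have E1 : E 1 = 0 := by simp [E]
  have Ew : ∀ a, E (gw k * a) = (0, 0, f (gz k) (gy k) (a - π a) + M.l (gz k) (E a).2.1, 0) := by
    intro a
    change (Φ (gw k * a) (1, 0)).2 = _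
    rw [map_mul, Module.End.mul_apply, hw, hW', h1]
    rfl
  have Ex : ∀ a, E (gx k * a) = (f (gw k) (gx k) a - M.l (gw k) (E a).2.1, 0, 0,
      f (gz k) (gy k) (π a) - M.l (gz k) (E a).1) := by
    intro a
    change (Φ (gx k * a) (1, 0)).2 = _
    rw [map_mul, Module.End.mul_apply, hx, hX', h1]
    rfl
  have Ez : ∀ a, E (gz k * a) = (0,
      f (gx k) (gz k) a - M.l (gx k) ((E a).2.2.1 - (E a).2.2.2), 0, 0) := by
    intro a
    change (Φ (gz k * a) (1, 0)).2 = _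
    rw [map_mul, Module.End.mul_apply, hz, hZ', h1]
    rfl
  refine ⟨CoeffBimod.ofLinear ((LinearMap.fst k _ _).comp E) (by simp [E1]),
    CoeffBimod.ofLinear ((LinearMap.fst k _ _).comp ((LinearMap.snd k _ _).comp E)) (by simp [E1]),
    CoeffBimod.ofLinear ((LinearMap.fst k M M - LinearMap.snd k M M).comp
      ((LinearMap.snd k _ _).comp ((LinearMap.snd k _ _).comp E))) (by simp [E1]),
    fun a => ?_, fun a => ?_, fun a => ?_⟩
  · simp [Ex]
  · simp [Ez]
  · simp only [CoeffBimod.ofLinear_app, LinearMap.comp_apply, gy_eq, sub_mul, map_sub, Ew, Ex,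
      LinearMap.sub_apply, LinearMap.fst_apply, LinearMap.snd_apply]
    abel

/-- After subtraction of the coboundary of the partial primitive, f vanishes at wx, xz, zy as a
2-cocycle with values in `M.shift`. -/
theorem exists_primitive_three {f : M.shift.shift.shift} (hf : M.shift.shift.shift.diff f = 0)
    (hwxz : f (gw k) (gx k) (gz k) = 0) (hxzy : f (gx k) (gz k) (gy k) = 0) :
    ∃ h : M.shift.shift, M.shift.shift.diff h = f := by
  obtain ⟨g₁, g₂, g₃, hg₁, hg₂, hg₃⟩ := exists_partial_primitive_three hf hwxz hxzy
  obtain ⟨g, hgw, hgx, hgz⟩ := exists_shift g₁ g₂ g₃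
  have hd : ∀ a b c, (f - M.shift.shift.diff g) a b c =
      f a b c - (M.l a (g b c) - g (a * b) c + g a (b * c) - M.r c (g a b)) := by
    intro a b c
    simp only [CoeffBimod.diff_app, map_sub, LinearMap.sub_apply, CoeffBimod.shift_l,
      CoeffBimod.shift_r]
    abel
  have e₁ := hg₁ 1
  have e₂ := hg₂ 1
  have e₃ := hg₃ 1
  simp only [mul_one, CoeffBimod.shift_one, map_zero, sub_self] at e₁ e₂ e₃
  obtain ⟨h, hh⟩ := exists_primitive_two (M := M.shift) (f := f - M.shift.shift.diff g)
    (by rw [map_sub, hf, CoeffBimod.diff_diff, sub_zero])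
    (by
      refine CoeffBimod.shift_ext fun a => ?_
      rw [hd, gw_mul_gx, hgw, hgx, hg₁, e₁]
      simp)
    (by
      refine CoeffBimod.shift_ext fun a => ?_
      rw [hd, gx_mul_gz, hgx, hgz, hg₂, e₂]
      simp)
    (by
      refine CoeffBimod.shift_ext fun a => ?_
      have e : g (gy k) = g₁ - g₂ := by rw [gy_eq, map_sub, hgw, hgx]
      rw [hd, gz_mul_gy, hgz, e, hg₃, e₃]
      simp)
  exact ⟨h + g, by rw [map_add, hh, sub_add_cancel]⟩

/-- A 3-cochain is sought whose coboundary agrees with f on arguments beginning with wxz and xzy. It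
needs values g₁ at xz and g₂ at wx, prescribed on yA and zA respectively. The former is consistent
because left multiplication by y is injective; the latter because za = 0 forces a = ys, where the
cocycle identity applies. -/
theorem exists_primitive_four {f : M.shift.shift.shift.shift}
    (hf : M.shift.shift.shift.shift.diff f = 0) (hwxzy : f (gw k) (gx k) (gz k) (gy k) = 0) :
    ∃ h : M.shift.shift.shift, M.shift.shift.shift.diff h = f := by
  obtain ⟨c, hc, hcw, hcx, hcz⟩ := exists_augmentation (k := k)
  have hcy : ∀ a, c (gy k * a) = 0 := fun a => by
    rw [gy_eq, sub_mul, map_sub, hcw, hcx, sub_zero]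
  have H : ∀ a, M.l (gw k) (f (gx k) (gz k) (gy k) a) + f (gw k) (gx k) (gz k) (gy k * a) = 0 := by
    intro e
    have h : (M.shift.shift.shift.shift.diff f) (gw k) (gx k) (gz k) (gy k) e = 0 := by
      rw [hf]; simp
    simp only [CoeffBimod.diff_app, map_sub, LinearMap.sub_apply, CoeffBimod.shift_l,
      CoeffBimod.shift_r] at h
    simp only [gw_mul_gx, gx_mul_gz, gz_mul_gy, hwxzy, map_zero, LinearMap.zero_apply, sub_zero,
      zero_sub, sub_neg_eq_add, zero_add] at h
    exact h
  obtain ⟨g₁, hg₁⟩ := exists_shift_mul (gy k) (-CoeffBimod.app (f (gx k) (gz k) (gy k))) hc hcy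
    (fun a ha => by rw [gy_mul_eq_zero ha, map_zero])
  obtain ⟨g₂, hg₂⟩ := exists_shift_mul (gz k)
    ((M.l (gw k)).comp (CoeffBimod.app g₁) - CoeffBimod.app (f (gw k) (gx k) (gz k))) hc hcz
    (fun a ha => by
      obtain ⟨s, rfl⟩ := gz_mul_eq_zero ha
      have h := H s
      simp only [LinearMap.sub_apply, LinearMap.comp_apply, hg₁, LinearMap.neg_apply, map_neg]
      rw [← neg_eq_zero, ← h]
      abel)
  obtain ⟨g', hgw', hgx', hgz'⟩ := exists_shift 0 g₂ 0
  obtain ⟨g'', hgw'', hgx'', hgz''⟩ := exists_shift 0 0 g₁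
  obtain ⟨g, hgw, hgx, hgz⟩ := exists_shift g' g'' 0
  have hd : ∀ a b c d, (f - M.shift.shift.shift.diff g) a b c d =
      f a b c d - (M.l a (g b c d) - g (a * b) c d + g a (b * c) d - g a b (c * d) +
        M.r d (g a b c)) := by
    intro a b c d
    simp only [CoeffBimod.diff_app, map_sub, LinearMap.sub_apply, CoeffBimod.shift_l,
      CoeffBimod.shift_r]
    abel
  have e₁ := hg₁ 1
  have e₂ := hg₂ 1
  simp only [mul_one, LinearMap.neg_apply, LinearMap.sub_apply, LinearMap.comp_apply,
    CoeffBimod.shift_one, map_zero, sub_self, neg_zero] at e₁ e₂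
  obtain ⟨h, hh⟩ := exists_primitive_three (M := M.shift) (f := f - M.shift.shift.shift.diff g)
    (by rw [map_sub, hf, CoeffBimod.diff_diff, sub_zero])
    (by
      refine CoeffBimod.shift_ext fun a => ?_
      rw [hd, gw_mul_gx, gx_mul_gz, hgw, hgx, hgx', hgz'', e₂, hg₂]
      simp)
    (by
      refine CoeffBimod.shift_ext fun a => ?_
      rw [hd, gx_mul_gz, gz_mul_gy, hgx, hgz, hgz'', e₁, hg₁]
      simp)
  exact ⟨h + g, by rw [map_add, hh, sub_add_cancel]⟩

/-- No segment has length 5: a cochain supported at wxz, with value g₁ on yA, corrects f on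
arguments beginning with wxzy. Injectivity of left multiplication by y is the only condition. -/
theorem exists_primitive_five {f : M.shift.shift.shift.shift.shift}
    (hf : M.shift.shift.shift.shift.shift.diff f = 0) :
    ∃ h : M.shift.shift.shift.shift, M.shift.shift.shift.shift.diff h = f := by
  obtain ⟨c, hc, hcw, hcx, -⟩ := exists_augmentation (k := k)
  obtain ⟨g₁, hg₁⟩ := exists_shift_mul (gy k) (CoeffBimod.app (f (gw k) (gx k) (gz k) (gy k))) hc
    (fun a => by rw [gy_eq, sub_mul, map_sub, hcw, hcx, sub_zero])
    (fun a ha => by rw [gy_mul_eq_zero ha, map_zero])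
  obtain ⟨g'', hgw'', hgx'', hgz''⟩ := exists_shift 0 0 g₁
  obtain ⟨g', hgw', hgx', hgz'⟩ := exists_shift 0 g'' 0
  obtain ⟨g, hgw, hgx, hgz⟩ := exists_shift g' 0 0
  have e₁ := hg₁ 1
  simp only [mul_one, CoeffBimod.shift_one] at e₁
  obtain ⟨h, hh⟩ := exists_primitive_four (M := M.shift)
    (f := f - M.shift.shift.shift.shift.diff g)
    (by rw [map_sub, hf, CoeffBimod.diff_diff, sub_zero])
    (by
      refine CoeffBimod.shift_ext fun a => ?_
      simp only [CoeffBimod.diff_app, map_sub, LinearMap.sub_apply, CoeffBimod.shift_l,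
        CoeffBimod.shift_r,
        gw_mul_gx, gx_mul_gz, gz_mul_gy, hgw, hgx, hgx', hgz'', e₁, hg₁]
      simp)
  exact ⟨h + g, by rw [map_add, hh, sub_add_cancel]⟩

end ISAlg

/-! ### Linear equations in `A` -/

/-- The facts about `w = x + y`, `x`, `y`, `z` in `k⟨x, y, z⟩ / (wx, xz, zy)` that determine its
Hochschild cohomology. -/
structure LineRelations (k : Type*) [Field k] {R : Type*} [Ring R] [Algebra k R] (w x y z : R) :
    Prop where
  gw_eq : w = x + y
  gw_mul_gx : w * x = 0
  gx_mul_gz : x * z = 0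
  gz_mul_gy : z * y = 0
  exists_left_eq : ∀ a : R, ∃ (c : k) (p q r : R), a = algebraMap k _ c + w * p + x * q + z * r
  exists_right_eq : ∀ a : R, ∃ (c : k) (p q r : R), a = algebraMap k _ c + p * x + q * y + r * z
  left_direct : ∀ {c : k} {p q r : R}, algebraMap k _ c + w * p + x * q + z * r = 0 →
    c = 0 ∧ w * p = 0 ∧ x * q = 0 ∧ z * r = 0
  right_direct : ∀ {c : k} {p q r : R}, algebraMap k _ c + p * x + q * y + r * z = 0 →
    c = 0 ∧ p * x = 0 ∧ q * y = 0 ∧ r * z = 0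
  gw_mul_eq_zero : ∀ {a : R}, w * a = 0 → ∃ s, a = x * s
  gx_mul_eq_zero : ∀ {a : R}, x * a = 0 → ∃ s, a = z * s
  gz_mul_eq_zero : ∀ {a : R}, z * a = 0 → ∃ s, a = y * s
  mul_gw_eq_zero : ∀ {a : R}, a * w = 0 → a = 0
  mul_gx_eq_zero : ∀ {a : R}, a * x = 0 → ∃ s, a = s * w
  mul_gy_eq_zero : ∀ {a : R}, a * y = 0 → ∃ s, a = s * z
  mul_gz_eq_zero : ∀ {a : R}, a * z = 0 → ∃ s, a = s * x

theorem ISAlg.lineRelations (k : Type*) [Field k] :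
    LineRelations k (gw k) (gx k) (gy k) (gz k) where
  gw_eq := rfl
  gw_mul_gx := gw_mul_gx k
  gx_mul_gz := gx_mul_gz k
  gz_mul_gy := gz_mul_gy k
  exists_left_eq := exists_left_eq
  exists_right_eq := exists_right_eq
  left_direct := left_direct
  right_direct := right_direct
  gw_mul_eq_zero := gw_mul_eq_zero
  gx_mul_eq_zero := gx_mul_eq_zero
  gz_mul_eq_zero := gz_mul_eq_zero
  mul_gw_eq_zero := mul_gw_eq_zero
  mul_gx_eq_zero := mul_gx_eq_zero
  mul_gy_eq_zero := mul_gy_eq_zero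
  mul_gz_eq_zero := mul_gz_eq_zero

namespace LineRelations

variable {k : Type*} [Field k] {R : Type*} [Ring R] [Algebra k R] {w x y z : R}

theorem gy_eq (S : LineRelations k w x y z) : y = w - x := by rw [S.gw_eq, add_sub_cancel_left]

theorem gw_mul_gy (S : LineRelations k w x y z) : w * y = w * w := by
  rw [S.gy_eq, mul_sub, S.gw_mul_gx, sub_zero]

/-- Write m = c + wα + xβ + zγ. The x- and z-components of mw - wm are xβw and zγw, so xβ = zγ = 0.
Commuting with x then gives xwα = 0, so wα lies in zA and vanishes. -/
theorem eq_scalar_of_commute (S : LineRelations k w x y z) {m : R} (hw : w * m = m * w)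
    (hx : x * m = m * x) :
    ∃ c, m = algebraMap k _ c := by
  obtain ⟨c, α, β, γ, rfl⟩ := S.exists_left_eq m
  refine ⟨c, ?_⟩
  have hcw : algebraMap k _ c * w = w * algebraMap k _ c := Algebra.commutes c _
  have hcx : algebraMap k _ c * x = x * algebraMap k _ c := Algebra.commutes c _
  -- The witnesses are the coefficients of mw - wm after c is moved past w; the calls of directness
  -- below follow the same pattern.
  obtain ⟨-, -, h₁, h₂⟩ := S.left_direct (c := 0)
    (p := algebraMap k _ c + α * w - (algebraMap k _ c + w * α + x * β + z * γ))
    (q := β * w) (r := γ * w) (by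
      refine Eq.trans ?_ (sub_eq_zero.2 hw.symm)
      simp only [map_zero, add_mul, hcw]
      noncomm_ring)
  rw [← mul_assoc] at h₁ h₂
  have h₁ := S.mul_gw_eq_zero h₁
  have h₂ := S.mul_gw_eq_zero h₂
  rw [h₁, h₂, add_zero, add_zero] at hx ⊢
  obtain ⟨-, -, h₃, -⟩ := S.left_direct (c := 0) (p := -(α * x)) (q := w * α) (r := 0) (by
      refine Eq.trans ?_ (sub_eq_zero.2 hx)
      simp only [map_zero, add_mul, hcx]
      noncomm_ring)
  obtain ⟨s, hs⟩ := S.gx_mul_eq_zero h₃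
  obtain ⟨-, h₄, -⟩ := S.left_direct (c := 0) (p := α) (q := 0) (r := -s) (by
      refine Eq.trans ?_ (sub_eq_zero.2 hs)
      simp only [map_zero]
      noncomm_ring)
  rw [h₄, add_zero]

/-- The part of a outside wA is annihilated by z on the right, so it lies in Ax. This treats the
value of a 2-cocycle at wx. -/
theorem eq_of_mul_gz (S : LineRelations k w x y z) {a b : R} (h : w * b = a * z) :
    ∃ α β, a = w * α + β * x := by
  obtain ⟨c, α, β, γ, rfl⟩ := S.exists_left_eq a
  have hc : algebraMap k _ c * z = z * algebraMap k _ c := Algebra.commutes c _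
  obtain ⟨-, -, h₁, h₂⟩ := S.left_direct (c := 0) (p := α * z - b)
    (q := β * z) (r := algebraMap k _ c + γ * z) (by
      refine Eq.trans ?_ (sub_eq_zero.2 h.symm)
      simp only [map_zero, add_mul, hc]
      noncomm_ring)
  obtain ⟨s, hs⟩ := S.mul_gz_eq_zero (a := algebraMap k _ c + x * β + z * γ) (by
    simp only [add_mul, hc, mul_assoc]
    rw [h₁, add_zero, ← mul_add, h₂])
  exact ⟨α, s, by rw [← hs]; abel⟩

/-- The part of a outside wA is annihilated by x on the right, so it lies in Aw. This treats the
value of a derivation at w. -/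
theorem eq_of_mul_gx (S : LineRelations k w x y z) {a b : R} (h : a * x + w * b = 0) :
    ∃ α β, a = w * α + β * w := by
  obtain ⟨c, α, β, γ, rfl⟩ := S.exists_left_eq a
  have hc : algebraMap k _ c * x = x * algebraMap k _ c := Algebra.commutes c _
  obtain ⟨-, -, h₁, h₂⟩ := S.left_direct (c := 0) (p := α * x + b)
    (q := algebraMap k _ c + β * x) (r := γ * x) (by
      refine Eq.trans ?_ h
      simp only [map_zero, add_mul, hc]
      noncomm_ring)
  obtain ⟨s, hs⟩ := S.mul_gx_eq_zero (a := algebraMap k _ c + x * β + z * γ) (by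
    simp only [add_mul, hc, mul_assoc]
    rw [h₂, add_zero, ← mul_add, h₁])
  exact ⟨α, s, by rw [← hs]; abel⟩

/-- The mirror argument: the part of a outside Ay is annihilated by x on the left. This treats the
value of a 2-cocycle at zy. -/
theorem eq_of_gx_mul (S : LineRelations k w x y z) {a b : R} (h : x * a = b * y) :
    ∃ α β, a = α * y + z * β := by
  obtain ⟨c, p, q, r, rfl⟩ := S.exists_right_eq a
  have hc : x * algebraMap k _ c = algebraMap k _ c * x := (Algebra.commutes c _).symm
  obtain ⟨-, h₁, -, h₂⟩ := S.right_direct (c := 0) (p := algebraMap k _ c + x * p)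
    (q := x * q - b) (r := x * r) (by
      refine Eq.trans ?_ (sub_eq_zero.2 h)
      simp only [map_zero, mul_add, hc]
      noncomm_ring)
  obtain ⟨s, hs⟩ := S.gx_mul_eq_zero (a := algebraMap k _ c + p * x + r * z) (by
    simp only [mul_add, hc, ← mul_assoc]
    rw [h₂, add_zero, ← add_mul, h₁])
  exact ⟨q, s, by rw [← hs]; abel⟩

/-- The hypothesis is the cocycle identity at wxzy for values a at wxz and b at xzy. The conclusion
presents them as the coboundary of values q, s, t at wx, xz, zy, so this is the vanishing of HH^3.
The scalar term c of b is excluded first: (c + wp)x = 0 has x-component xc, so c lies in zA. -/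
theorem eq_of_gw_mul_add (S : LineRelations k w x y z) {a b : R} (h : w * b + a * y = 0) :
    ∃ q s t, b = x * t - s * y ∧ a = w * s - q * z := by
  obtain ⟨c, p, q, r, rfl⟩ := S.exists_right_eq b
  have hc : w * algebraMap k _ c = algebraMap k _ c * x + algebraMap k _ c * y := by
    rw [← Algebra.commutes c, S.gw_eq, mul_add]
  obtain ⟨-, h₁, h₂, h₃⟩ := S.right_direct (c := 0) (p := algebraMap k _ c + w * p)
    (q := algebraMap k _ c + w * q + a) (r := w * r) (by
      refine Eq.trans ?_ h
      simp only [map_zero, mul_add, hc]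
      noncomm_ring)
  obtain ⟨-, -, h₄, -⟩ := S.left_direct (c := 0) (p := p * x) (q := algebraMap k _ c) (r := 0) (by
    refine Eq.trans ?_ h₁
    rw [add_mul, Algebra.commutes c]
    simp only [map_zero]
    noncomm_ring)
  obtain ⟨s, hs⟩ := S.gx_mul_eq_zero h₄
  obtain ⟨h₅, -⟩ := S.left_direct (c := c) (p := 0) (q := 0) (r := -s) (by
    refine Eq.trans ?_ (sub_eq_zero.2 hs)
    noncomm_ring)
  simp only [h₅, map_zero, zero_add] at h₁ h₂ ⊢
  obtain ⟨t, ht⟩ := S.gw_mul_eq_zero (a := p * x + r * z) (by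
    simp only [mul_add, ← mul_assoc]
    rw [h₁, h₃, add_zero])
  obtain ⟨q', hq'⟩ := S.mul_gy_eq_zero h₂
  refine ⟨-q', -q, t, by rw [← ht, neg_mul]; abel, ?_⟩
  rw [neg_mul, ← hq', mul_neg]
  abel

/-- As pw x = awx = 0, the relations can be solved in the order wx, xz, zy, each by one left
annihilator. -/
theorem exists_form_of_derivation (S : LineRelations k w x y z) {a pw px pz : R} (hw : pw = a * w)
    (h₁ : pw * x + w * px = 0) (h₂ : px * z + x * pz = 0)
    (h₃ : pz * y + z * (pw - px) = 0) :
    ∃ c e h, px = x * c ∧ pz = z * e - c * z ∧ pw - px = y * h - e * y := by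
  rw [hw, mul_assoc, S.gw_mul_gx, mul_zero, zero_add] at h₁
  obtain ⟨c, rfl⟩ := S.gw_mul_eq_zero h₁
  obtain ⟨e, he⟩ := S.gx_mul_eq_zero (a := c * z + pz) (by rw [← h₂]; noncomm_ring)
  have he' : pz = z * e - c * z := by rw [← he]; abel
  obtain ⟨h, hh⟩ := S.gz_mul_eq_zero (a := e * y + (pw - x * c)) (by
    rw [← h₃, he', sub_mul, mul_assoc c, S.gz_mul_gy]
    noncomm_ring)
  exact ⟨c, e, h, rfl, he', by rw [← hh]; abel⟩

/-- By H, ey = xc + yh - aw, so only awh' matters. Modulo xA + yA, which contains wA, it is zγwh'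
with zγ from the z-component of a. Comparing z-components in H gives zγ = bw, and H' multiplied by w
on the left puts wwh' in Aw + Ay. -/
theorem mul_gy_mul_mem (S : LineRelations k w x y z) {a c e h a' c' e' h' : R}
    (H : a * w - x * c = y * h - e * y)
    (H' : a' * w - x * c' = y * h' - e' * y) :
    ∃ p q r s, e * y * h' = x * p + y * q + r * y + s * w := by
  obtain ⟨c₀, α, β, γ, rfl⟩ := S.exists_left_eq a
  obtain ⟨e₀, α', β', γ', rfl⟩ := S.exists_left_eq e
  have hc : algebraMap k _ c₀ * w = w * algebraMap k _ c₀ := Algebra.commutes c₀ _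
  have hy : y = w - x := S.gy_eq
  have he : algebraMap k _ e₀ * y = y * algebraMap k _ e₀ := Algebra.commutes e₀ _
  obtain ⟨-, -, -, h₁⟩ := S.left_direct (c := 0)
    (p := α' * y + algebraMap k _ e₀ + algebraMap k _ c₀ + α * w - h)
    (q := β' * y - algebraMap k _ e₀ + β * w - c + h) (r := γ' * y + γ * w) (by
      refine Eq.trans ?_ (sub_eq_zero.2 H)
      simp only [map_zero, add_mul, hc, he]
      simp only [hy]
      noncomm_ring)
  -- Here z(γ'y + γw) = zγx + (zγ' + zγ)y, so zγx = 0.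
  obtain ⟨-, h₂, -⟩ := S.right_direct (c := 0) (p := z * γ) (q := z * γ' + z * γ) (r := 0) (by
      refine Eq.trans ?_ h₁
      rw [S.gw_eq]
      simp only [map_zero]
      noncomm_ring)
  obtain ⟨b, hb⟩ := S.mul_gx_eq_zero h₂
  -- The relation wx = 0 turns wy into ww.
  have H₁ : w * w * h' = w * a' * w + w * e' * y := by
    have h := congrArg (w * ·) H'
    simp only [mul_sub, ← mul_assoc, S.gw_mul_gx, S.gw_mul_gy, zero_mul, sub_zero] at h
    rw [h, sub_add_cancel]
  have H₂ : ∀ t, w * t = x * t + y * t := fun t => by rw [S.gw_eq, add_mul]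
  have H₃ : (algebraMap k R e₀ + w * α' + x * β' + z * γ') * y =
      x * c + y * h - (algebraMap k R c₀ + w * α + x * β + z * γ) * w := by
    rw [eq_sub_iff_add_eq, ← sub_eq_iff_eq_add', ← sub_eq_zero, ← sub_eq_zero.2 H]
    abel
  refine ⟨c * h' - (algebraMap k R c₀ * h' + α * w * h') - β * w * h',
    h * h' - (algebraMap k R c₀ * h' + α * w * h'), -(b * w * e'), -(b * w * a'), ?_⟩
  have H₄ : (algebraMap k R c₀ + w * α + x * β + z * γ) * w * h' =
      w * (algebraMap k R c₀ * h' + α * w * h') + x * (β * w * h') +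
        b * (w * a' * w + w * e' * y) := by
    rw [hb, ← H₁]
    simp only [add_mul, hc]
    noncomm_ring
  rw [H₃, sub_mul, H₄, H₂]
  noncomm_ring

/-- The cup product of two normalized derivations is a coboundary. -/
theorem exists_primitive_cup (S : LineRelations k w x y z) {a pw px pz a' pw' px' pz' : R}
    (hw : pw = a * w) (h₁ : pw * x + w * px = 0) (h₂ : px * z + x * pz = 0)
    (h₃ : pz * y + z * (pw - px) = 0)
    (hw' : pw' = a' * w) (h₁' : pw' * x + w * px' = 0) (h₂' : px' * z + x * pz' = 0)
    (h₃' : pz' * y + z * (pw' - px') = 0) :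
    ∃ uw ux uz, uw * x + w * ux = pw * px' ∧ ux * z + x * uz = px * pz' ∧
      uz * y + z * (uw - ux) = pz * (pw' - px') := by
  obtain ⟨c, e, h, hx, hz, hy⟩ := S.exists_form_of_derivation hw h₁ h₂ h₃
  obtain ⟨c', e', h', hx', hz', hy'⟩ := S.exists_form_of_derivation hw' h₁' h₂' h₃'
  obtain ⟨p, q, r, s, H⟩ := S.mul_gy_mul_mem
    (show a * w - x * c = y * h - e * y by rw [← hw, ← hx, hy])
    (show a' * w - x * c' = y * h' - e' * y by rw [← hw', ← hx', hy'])
  have R₁ : ∀ t, w * (x * t) = 0 := fun t => by rw [← mul_assoc, S.gw_mul_gx, zero_mul]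
  have R₂ : ∀ t, x * (z * t) = 0 := fun t => by rw [← mul_assoc, S.gx_mul_gz, zero_mul]
  have R₃ : ∀ t, z * (y * t) = 0 := fun t => by rw [← mul_assoc, S.gz_mul_gy, zero_mul]
  have Hu : s * w - -(x * p) = e * y * h' - y * q - r * y := by
    rw [H]
    abel
  -- Since uw = sw and ux = -xp, both sides of the equation at wx vanish. In z(uw - ux) the term yq
  -- is lost to zy = 0, and zr in uz restores ry. The last term of uz absorbs xcc'z and the
  -- contribution of p at xz.
  refine ⟨s * w, -(x * p), -((z * e - c * z) * e') + z * r - (c * c' - p) * z, ?_, ?_, ?_⟩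
  · rw [hw, hx']
    simp only [mul_assoc, mul_neg, R₁, S.gw_mul_gx, mul_zero, neg_zero, add_zero]
  · rw [hx, hz']
    simp only [mul_sub, sub_mul, mul_add, neg_mul, neg_sub, mul_assoc, R₂]
    abel
  · rw [hz, hy', Hu]
    simp only [mul_sub, sub_mul, add_mul, neg_sub, mul_assoc, R₃, S.gz_mul_gy, mul_zero]
    abel

end LineRelations

/-! ### Vanishing of HH^3 and of the cup products -/

namespace ISAlg

open Hochschild

universe u

variable {k : Type u} [Field k]

/-- The algebra as a bimodule over itself. -/
abbrev reg (k : Type u) [Field k] : CoeffBimod k (ISAlg k) := CoeffBimod.regular k (ISAlg k)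

/-- The identification of the regular bimodule with the algebra. -/
def val : reg k ≃ₗ[k] ISAlg k := LinearEquiv.refl k (ISAlg k)

theorem val_l (a : ISAlg k) (m : reg k) : val ((reg k).l a m) = a * val m := rfl

theorem val_r (a : ISAlg k) (m : reg k) : val ((reg k).r a m) = val m * a := rfl

theorem derivation_relation {f : (reg k).shift} (hf : (reg k).shift.diff f = 0) {a b : ISAlg k}
    (hab : a * b = 0) : val (f a) * b + a * val (f b) = 0 := by
  have h : ((reg k).shift.diff f) a b = 0 := by rw [hf]; simp
  simp only [CoeffBimod.diff_app, map_sub, LinearMap.sub_apply, CoeffBimod.shift_l,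
    CoeffBimod.shift_r, hab, map_zero, zero_sub, sub_neg_eq_add] at h
  rw [← val_l, ← val_r, ← map_add, add_comm, h, map_zero]

theorem two_cocycle_relation {f : (reg k).shift.shift} (hf : (reg k).shift.shift.diff f = 0)
    {a b c : ISAlg k} (hab : a * b = 0) (hbc : b * c = 0) :
    a * val (f b c) = val (f a b) * c := by
  have h : ((reg k).shift.shift.diff f) a b c = 0 := by rw [hf]; simp
  simp only [CoeffBimod.diff_app, map_sub, LinearMap.sub_apply, CoeffBimod.shift_l,
    CoeffBimod.shift_r] at h
  simp only [hab, hbc, map_zero, LinearMap.zero_apply, zero_sub, sub_neg_eq_add, zero_add,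
    sub_eq_zero] at h
  rw [← val_l, ← val_r, h]

theorem exists_primitive_three_regular {f : (reg k).shift.shift.shift}
    (hf : (reg k).shift.shift.shift.diff f = 0) :
    ∃ h : (reg k).shift.shift, (reg k).shift.shift.diff h = f := by
  have H : gw k * val (f (gx k) (gz k) (gy k)) + val (f (gw k) (gx k) (gz k)) * gy k = 0 := by
    have h := cocycle_three hf (gw k) (gx k) (gz k) (gy k)
    simp only [gw_mul_gx, gx_mul_gz, gz_mul_gy, map_zero, LinearMap.zero_apply, sub_zero,
      add_zero] at h
    rw [← val_l, ← val_r, ← map_add, h, map_zero]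
  -- The cochain g below takes the values q, s, t at wx, xz, zy.
  obtain ⟨q, s, t, h₁, h₂⟩ := (lineRelations k).eq_of_gw_mul_add H
  obtain ⟨g₁, -, hg₁x, -⟩ := exists_shift (M := reg k) 0 (val.symm q) 0
  obtain ⟨g₂, -, -, hg₂⟩ := exists_shift (M := reg k) 0 0 (val.symm s)
  obtain ⟨g₃, hg₃w, hg₃x, -⟩ := exists_shift (M := reg k) (val.symm t) 0 0
  obtain ⟨g, hgw, hgx, hgz⟩ := exists_shift g₁ g₂ g₃
  have hd : ∀ a b c, a * b = 0 → b * c = 0 → (f - (reg k).shift.shift.diff g) a b c =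
      f a b c - ((reg k).l a (g b c) - (reg k).r c (g a b)) := by
    intro a b c hab hbc
    simp only [CoeffBimod.diff_app, map_sub, LinearMap.sub_apply, CoeffBimod.shift_l,
      CoeffBimod.shift_r]
    simp only [hab, hbc, map_zero, LinearMap.zero_apply, zero_sub, sub_neg_eq_add, zero_add]
  obtain ⟨h, hh⟩ := exists_primitive_three (f := f - (reg k).shift.shift.diff g)
    (by rw [map_sub, hf, CoeffBimod.diff_diff, sub_zero])
    (by
      rw [hd _ _ _ (gw_mul_gx k) (gx_mul_gz k), hgw, hgx, hg₁x, hg₂, sub_eq_zero]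
      exact h₂)
    (by
      have e : g₃ (gy k) = val.symm t := by rw [gy_eq, map_sub, hg₃w, hg₃x, sub_zero]
      rw [hd _ _ _ (gx_mul_gz k) (gz_mul_gy k), hgx, hgz, hg₂, e, sub_eq_zero]
      exact h₁)
  exact ⟨h + g, by rw [map_add, hh, sub_add_cancel]⟩

/-- A 3-cochain u has du(w,x,z,y) = w u(x,z,y) + u(w,x,z) y. With f(w,x) = wα + βx and g(z,y) = γy +
zδ, the values u(x,z,y) = α g(z,y) and u(w,x,z) = βxγ give the product, as xz = 0. -/
theorem exists_primitive_cup_two_two {f g : (reg k).shift.shift}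
    {φ : (reg k).shift.shift.shift.shift} (hf : (reg k).shift.shift.diff f = 0)
    (hg : (reg k).shift.shift.diff g = 0) (hφ : (reg k).shift.shift.shift.shift.diff φ = 0)
    (h : val (φ (gw k) (gx k) (gz k) (gy k)) = val (f (gw k) (gx k)) * val (g (gz k) (gy k))) :
    ∃ ψ : (reg k).shift.shift.shift, (reg k).shift.shift.shift.diff ψ = φ := by
  obtain ⟨α, β, h₁⟩ := (lineRelations k).eq_of_mul_gz
    (two_cocycle_relation hf (gw_mul_gx k) (gx_mul_gz k))
  obtain ⟨γ, δ, h₂⟩ := (lineRelations k).eq_of_gx_mul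
    (two_cocycle_relation hg (gx_mul_gz k) (gz_mul_gy k))
  obtain ⟨u₁, -, -, hu₁⟩ := exists_shift (M := reg k) 0 0 (val.symm (β * gx k * γ))
  obtain ⟨u₂, hu₂w, hu₂x, -⟩ := exists_shift (M := reg k)
    (val.symm (α * val (g (gz k) (gy k)))) 0 0
  obtain ⟨v₁, -, hv₁, -⟩ := exists_shift 0 u₁ 0
  obtain ⟨v₂, -, -, hv₂⟩ := exists_shift 0 0 u₂
  obtain ⟨u, huw, hux, -⟩ := exists_shift v₁ v₂ 0
  have hd : ((reg k).shift.shift.shift.diff u) (gw k) (gx k) (gz k) (gy k) =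
      (reg k).l (gw k) (u (gx k) (gz k) (gy k)) + (reg k).r (gy k) (u (gw k) (gx k) (gz k)) := by
    simp only [CoeffBimod.diff_app, map_sub, LinearMap.sub_apply, CoeffBimod.shift_l,
      CoeffBimod.shift_r]
    simp only [gw_mul_gx, gx_mul_gz, gz_mul_gy, map_zero, LinearMap.zero_apply, zero_sub,
      sub_neg_eq_add, zero_add]
  have e : u₂ (gy k) = val.symm (α * val (g (gz k) (gy k))) := by
    rw [← hu₂w, ← sub_zero (u₂ (gw k)), ← hu₂x, ← map_sub, ← gy_eq]
  obtain ⟨ψ, hψ⟩ := exists_primitive_four (f := φ - (reg k).shift.shift.shift.diff u)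
    (by rw [map_sub, hφ, CoeffBimod.diff_diff, sub_zero])
    (by
      simp only [map_sub, LinearMap.sub_apply]
      rw [hd, huw, hux, hv₁, hv₂, hu₁, e, sub_eq_zero]
      refine val.injective (h.trans ?_)
      rw [map_add, val_l, val_r, LinearEquiv.apply_symm_apply, LinearEquiv.apply_symm_apply, h₁,
        add_mul, mul_assoc (gw k)]
      refine congrArg (gw k * (α * val (g (gz k) (gy k))) + ·) ?_
      rw [h₂, mul_add, mul_assoc _ (gx k) (gz k * δ), ← mul_assoc (gx k), gx_mul_gz, zero_mul,
        mul_zero, add_zero, mul_assoc _ γ])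
  exact ⟨ψ + u, by rw [map_add, hψ, sub_add_cancel]⟩

/-- The solution of `exists_primitive_cup` gives a 1-cochain u with du = f ⊗ g at wx, xz, zy. Since
φ = -f ⊗ g, with the sign of the cup product in degrees (1,1), φ + du vanishes there. -/
theorem exists_primitive_cup_one_one {f g : (reg k).shift} {φ : (reg k).shift.shift}
    (hf : (reg k).shift.diff f = 0) (hg : (reg k).shift.diff g = 0)
    (hφ : (reg k).shift.shift.diff φ = 0) {a b : ISAlg k} (hfw : val (f (gw k)) = a * gw k)
    (hgw : val (g (gw k)) = b * gw k)
    (h : ∀ s t, φ s t + val.symm (val (f s) * val (g t)) = 0) :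
    ∃ ψ : (reg k).shift, (reg k).shift.diff ψ = φ := by
  have hy : ∀ f : (reg k).shift, val (f (gy k)) = val (f (gw k)) - val (f (gx k)) := fun f => by
    rw [gy_eq, map_sub, map_sub]
  have hf₃ := derivation_relation hf (gz_mul_gy k)
  have hg₃ := derivation_relation hg (gz_mul_gy k)
  rw [hy] at hf₃ hg₃
  obtain ⟨uw, ux, uz, h₁, h₂, h₃⟩ := (lineRelations k).exists_primitive_cup hfw
    (derivation_relation hf (gw_mul_gx k)) (derivation_relation hf (gx_mul_gz k)) hf₃ hgw
    (derivation_relation hg (gw_mul_gx k)) (derivation_relation hg (gx_mul_gz k)) hg₃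
  obtain ⟨u, huw, hux, huz⟩ := exists_shift (M := reg k) (val.symm uw) (val.symm ux) (val.symm uz)
  have huy : u (gy k) = val.symm (uw - ux) := by rw [gy_eq, map_sub, huw, hux, map_sub]
  have hd : ∀ s t, s * t = 0 → (reg k).r t (u s) + (reg k).l s (u t) =
      val.symm (val (f s) * val (g t)) → (φ + (reg k).shift.diff u) s t = 0 := by
    intro s t hst e
    rw [← h s t, ← e]
    simp only [map_add, LinearMap.add_apply, CoeffBimod.diff_app, map_sub, LinearMap.sub_apply,
      CoeffBimod.shift_l, CoeffBimod.shift_r, hst, map_zero]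
    abel
  obtain ⟨ψ, hψ⟩ := exists_primitive_two (f := φ + (reg k).shift.diff u)
    (by rw [map_add, hφ, CoeffBimod.diff_diff, add_zero])
    (hd _ _ (gw_mul_gx k) (by rw [huw, hux]; exact h₁))
    (hd _ _ (gx_mul_gz k) (by rw [huz, hux]; exact h₂))
    (hd _ _ (gz_mul_gy k) (by rw [huz, huy, hy]; exact h₃))
  exact ⟨ψ - u, by rw [map_sub, hψ, add_sub_cancel_right]⟩

theorem mem_coboundaries_three {f : Cochain k (ISAlg k) 3} (hf : f ∈ cocycles k (ISAlg k) 3) :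
    f ∈ coboundaries k (ISAlg k) 3 := by
  obtain ⟨φ, hφ, e⟩ := exists_iterCochain_of_cocycle hf
  exact mem_coboundaries_of_iter e (exists_primitive_three_regular hφ)

theorem mem_coboundaries_add_five {n : ℕ} {f : Cochain k (ISAlg k) (n + 5)}
    (hf : f ∈ cocycles k (ISAlg k) (n + 5)) : f ∈ coboundaries k (ISAlg k) (n + 5) := by
  obtain ⟨φ, hφ, e⟩ := exists_iterCochain_of_cocycle hf
  exact mem_coboundaries_of_iter e (exists_primitive_five (M := iterCochain k (ISAlg k) n) hφ)

theorem cupCochain_mem_cocycles {m n p : ℕ} (h : m + n = p) {f : Cochain k (ISAlg k) m}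
    {g : Cochain k (ISAlg k) n} (hf : f ∈ cocycles k (ISAlg k) m)
    (hg : g ∈ cocycles k (ISAlg k) n) :
    cupCochain k (ISAlg k) h f g ∈ cocycles k (ISAlg k) p :=
  (cupCocycle k (ISAlg k) h ⟨f, hf⟩ ⟨g, hg⟩).2

theorem seqEval_cup {m n p : ℕ} (h : m + n = p) {f : Cochain k (ISAlg k) m}
    {g : Cochain k (ISAlg k) n} {F : iterCochain k (ISAlg k) m} {G : iterCochain k (ISAlg k) n}
    {φ : iterCochain k (ISAlg k) p} (hF : ∀ b, seqEval m F b = f.toMap (fun i => b i))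
    (hG : ∀ b, seqEval n G b = g.toMap (fun i => b i))
    (hφ : ∀ b, seqEval p φ b = (cupCochain k (ISAlg k) h f g).toMap (fun i => b i))
    (b : ℕ → ISAlg k) : seqEval p φ b =
      (-1 : k) ^ (m * n) • (seqEval m F b * seqEval n G (fun j => b (m + j))) := by
  rw [hφ, cupCochain_seq, hF, hG]

theorem cup_two_two_mem {f g : Cochain k (ISAlg k) 2} (hf : f ∈ cocycles k (ISAlg k) 2)
    (hg : g ∈ cocycles k (ISAlg k) 2) (h : 2 + 2 = 4) :
    cupCochain k (ISAlg k) h f g ∈ coboundaries k (ISAlg k) 4 := by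
  obtain ⟨F, hF, eF⟩ := exists_iterCochain_of_cocycle hf
  obtain ⟨G, hG, eG⟩ := exists_iterCochain_of_cocycle hg
  obtain ⟨φ, hφ, e⟩ := exists_iterCochain_of_cocycle (cupCochain_mem_cocycles h hf hg)
  refine mem_coboundaries_of_iter e (exists_primitive_cup_two_two hF hG hφ ?_)
  -- Only the first four terms w, x, z, y of the sequence are read.
  have H := seqEval_cup h eF eG e fun i => [gw k, gx k, gz k, gy k].getD i 0
  rw [show (-1 : k) ^ (2 * 2) = 1 by norm_num, one_smul] at H
  exact H

/-- Modulo inner derivations, a derivation maps `w` into `Aw`. -/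
theorem exists_normalized_derivation {f : Cochain k (ISAlg k) 1}
    (hf : f ∈ cocycles k (ISAlg k) 1) :
    ∃ f' ∈ cocycles k (ISAlg k) 1, f - f' ∈ coboundaries k (ISAlg k) 1 ∧
      ∃ φ : (reg k).shift, (reg k).shift.diff φ = 0 ∧
        (∀ b, seqEval 1 φ b = f'.toMap (fun i => b i)) ∧ ∃ a : ISAlg k, val (φ (gw k)) = a * gw k := by
  obtain ⟨φ, hφ, e⟩ : ∃ φ : (reg k).shift, (reg k).shift.diff φ = 0 ∧
      ∀ b, seqEval 1 φ b = f.toMap (fun i => b i) := exists_iterCochain_of_cocycle hf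
  obtain ⟨α, β, h⟩ := (lineRelations k).eq_of_mul_gx (derivation_relation hφ (gw_mul_gx k))
  obtain ⟨F, hF⟩ := exists_cochain (k := k) (A := ISAlg k) 0
  -- If f(w) = wα + βw, subtracting the inner derivation wα - αw leaves (β + α)w.
  have hc : d k (ISAlg k) 0 (F α) ∈ coboundaries k (ISAlg k) 1 := ⟨_, rfl⟩
  refine ⟨f - d k (ISAlg k) 0 (F α), Submodule.sub_mem _ hf (coboundaries_le_cocycles _ _ _ hc),
    by rwa [sub_sub_cancel], φ - (reg k).diff (val.symm α), ?_, fun b => ?_, β + α, ?_⟩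
  · rw [map_sub, CoeffBimod.diff_diff, sub_zero]
    exact hφ
  · refine (seqEval_sub 1 φ ((reg k).diff (val.symm α)) b).trans ?_
    rw [e]
    exact congrArg (f.toMap (fun i => b i) - ·)
      (seqEval_diff 0 (val.symm α) (F α) (fun b => (hF α b).symm) b)
  · rw [map_sub, LinearMap.sub_apply, CoeffBimod.diff_app, map_sub, map_sub, val_l, val_r, h,
      LinearEquiv.apply_symm_apply, add_mul]
    abel

theorem cup_one_one_mem {f g : Cochain k (ISAlg k) 1} (hf : f ∈ cocycles k (ISAlg k) 1)
    (hg : g ∈ cocycles k (ISAlg k) 1) (h : 1 + 1 = 2) :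
    cupCochain k (ISAlg k) h f g ∈ coboundaries k (ISAlg k) 2 := by
  obtain ⟨f', hf', ef, F, hF, eF, a, ha⟩ := exists_normalized_derivation hf
  obtain ⟨g', hg', eg, G, hG, eG, b, hb⟩ := exists_normalized_derivation hg
  have H : cupCochain k (ISAlg k) h f' g' ∈ coboundaries k (ISAlg k) 2 := by
    obtain ⟨φ, hφ, e⟩ := exists_iterCochain_of_cocycle (cupCochain_mem_cocycles h hf' hg')
    refine mem_coboundaries_of_iter e (exists_primitive_cup_one_one hF hG hφ ha hb fun s t => ?_)
    have H : ∀ u v : reg k, u = (-1 : k) ^ (1 * 1) • v → u + v = 0 := by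
      rintro _ v rfl
      simp
    exact H _ _ (seqEval_cup h eF eG e fun i => [s, t].getD i 0)
  have e : cupCochain k (ISAlg k) h f g = cupCochain k (ISAlg k) h (f - f') g +
      (cupCochain k (ISAlg k) h f' (g - g') + cupCochain k (ISAlg k) h f' g') := by
    rw [map_sub, map_sub, LinearMap.sub_apply, sub_add_cancel, sub_add_cancel]
  rw [e]
  exact Submodule.add_mem _ (cup_coboundary_left _ _ h ef hg)
    (Submodule.add_mem _ (cup_coboundary_right _ _ h hf' eg) H)

theorem cupCochain_mem_coboundaries {m n p : ℕ} (h : m + n = p) (hm : 1 ≤ m) (hn : 1 ≤ n)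
    {f : Cochain k (ISAlg k) m} {g : Cochain k (ISAlg k) n} (hf : f ∈ cocycles k (ISAlg k) m)
    (hg : g ∈ cocycles k (ISAlg k) n) :
    cupCochain k (ISAlg k) h f g ∈ coboundaries k (ISAlg k) p := by
  have hc := cupCochain_mem_cocycles h hf hg
  rcases lt_or_ge p 5 with hp | hp
  -- In total degree below 5 every pair other than (1,1) and (2,2) has total degree 3 or a factor of
  -- degree 3.
  · obtain ⟨rfl, rfl⟩ | rfl | ⟨rfl, rfl⟩ | rfl | rfl :
        (m = 1 ∧ n = 1) ∨ p = 3 ∨ (m = 2 ∧ n = 2) ∨ n = 3 ∨ m = 3 := by omega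
    · subst h
      exact cup_one_one_mem hf hg rfl
    · exact mem_coboundaries_three hc
    · subst h
      exact cup_two_two_mem hf hg rfl
    · exact cup_coboundary_right _ _ h hf (mem_coboundaries_three hg)
    · exact cup_coboundary_left _ _ h (mem_coboundaries_three hf) hg
  · obtain ⟨q, rfl⟩ := Nat.exists_eq_add_of_le' hp
    exact mem_coboundaries_add_five hc

theorem cup_eq_zero {m n p : ℕ} (h : m + n = p) (hm : 1 ≤ m) (hn : 1 ≤ n) :
    cup k (ISAlg k) h = 0 := by
  refine LinearMap.ext fun α => LinearMap.ext fun β => ?_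
  obtain ⟨f, rfl⟩ := Submodule.mkQ_surjective _ α
  obtain ⟨g, rfl⟩ := Submodule.mkQ_surjective _ β
  exact (Submodule.Quotient.mk_eq_zero _).2 (cupCochain_mem_coboundaries h hm hn f.2 g.2)

theorem scalarClass_bijective : Function.Bijective (scalarClass k (ISAlg k)) := by
  constructor
  · rw [← LinearMap.ker_eq_bot, LinearMap.ker_eq_bot']
    intro c hc
    have h : c • Cochain.mk (MultilinearMap.constOfIsEmpty k (fun _ : Fin 0 => ISAlg k) 1)
        (fun _ i => i.elim0) = 0 := (Submodule.Quotient.mk_eq_zero _).1 hc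
    have h₁ : c • (1 : ISAlg k) = 0 := congrArg (fun f => f.toMap fun i => i.elim0) h
    obtain ⟨ε, hε, -⟩ := exists_augmentation (k := k)
    simpa [hε] using congrArg ε h₁
  · intro α
    obtain ⟨f, rfl⟩ := Submodule.mkQ_surjective _ α
    obtain ⟨φ, hφ, e⟩ : ∃ φ : reg k, (reg k).diff φ = 0 ∧
      ∀ b, seqEval 0 φ b = f.1.toMap (fun i => b i) := exists_iterCochain_of_cocycle f.2
    have H : ∀ a, a * val φ = val φ * a := by
      intro a
      have h : ((reg k).diff φ) a = 0 := by rw [hφ]; simp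
      rw [CoeffBimod.diff_app, sub_eq_zero] at h
      rw [← val_l, ← val_r, h]
    -- A 0-cocycle is a central element; commuting with w and x already forces it to be a scalar.
    obtain ⟨c, hc⟩ := (lineRelations k).eq_scalar_of_commute (H _) (H _)
    refine ⟨c, congrArg _ (Subtype.ext (Cochain.ext fun a => ?_))⟩
    obtain ⟨b, rfl⟩ := exists_seq a
    refine Eq.trans ?_ (e b)
    refine Eq.trans ?_ hc.symm
    exact (Algebra.algebraMap_eq_smul_one c).symm

end ISAlg

/-! ### Scalars in the cup product -/

namespace Hochschild

variable {k : Type*} [Field k] {A : Type*} [Ring A] [Algebra k A]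

theorem cup_scalarClass (n : ℕ) (c : k) (α : HH k A n) :
    cup k A (Nat.add_zero n) α (scalarClass k A c) = c • α := by
  obtain ⟨f, rfl⟩ := Submodule.mkQ_surjective _ α
  refine congrArg _ (Subtype.ext (Cochain.ext fun a => ?_))
  change (-1 : k) ^ (n * 0) • (f.1.toMap _ * c • (1 : A)) = c • f.1.toMap a
  rw [mul_zero, pow_zero, one_smul, mul_smul_comm, mul_one]
  rfl

theorem scalarClass_cup (n : ℕ) (c : k) (α : HH k A n) :
    cup k A (Nat.zero_add n) (scalarClass k A c) α = c • α := by
  obtain ⟨f, rfl⟩ := Submodule.mkQ_surjective _ α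
  refine congrArg _ (Subtype.ext (Cochain.ext fun a => ?_))
  change (-1 : k) ^ (0 * n) • (c • (1 : A) * f.1.toMap _) = c • f.1.toMap a
  rw [zero_mul, pow_zero, one_smul, smul_mul_assoc, one_mul]
  congr 2
  ext i
  congr 1
  ext
  simp

end Hochschild

theorem mainTheorem8 (k : Type*) [Field k] [CharZero k] :
    -- `HH^0(A) = k`
    Function.Bijective (Hochschild.scalarClass k (ISAlg k)) ∧
    -- cup products with elements of `HH^0(A) = k` are scalar multiplications
    (∀ (n : ℕ) (c : k) (α : Hochschild.HH k (ISAlg k) n),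
      Hochschild.cup k (ISAlg k) (Nat.add_zero n) α (Hochschild.scalarClass k (ISAlg k) c) = c • α ∧
      Hochschild.cup k (ISAlg k) (Nat.zero_add n) (Hochschild.scalarClass k (ISAlg k) c) α = c • α) ∧
    -- all other cup products vanish
    (∀ (m n p : ℕ) (h : m + n = p), 1 ≤ m → 1 ≤ n → Hochschild.cup k (ISAlg k) h = 0) ∧
    -- in particular `∪_{-1,-1} = 0` and `∪_{-2,-2} = 0`
    Hochschild.cup k (ISAlg k) (show 1 + 1 = 2 from rfl) = 0 ∧
    Hochschild.cup k (ISAlg k) (show 2 + 2 = 4 from rfl) = 0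
 :=
  ⟨ISAlg.scalarClass_bijective,
    fun n c α => ⟨Hochschild.cup_scalarClass n c α, Hochschild.scalarClass_cup n c α⟩,
    fun _ _ _ h hm hn => ISAlg.cup_eq_zero h hm hn, ISAlg.cup_eq_zero _ le_rfl le_rfl,
    ISAlg.cup_eq_zero _ one_le_two one_le_two⟩
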